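/- An oriented graph is a finite digraph without loops and without digons (pairs of opposite arcs); its order is its number of vertices. For a set $X$ of vertices of an oriented graph $D$, the inversion of $X$ reverses all arcs of $D$ with both endvertices in $X$ and keeps all other arcs. For a positive integer $p$, $D$ is called $(=p)$-invertible if it can be made acyclic by a finite (possibly empty) sequence of inversions of vertex sets of size exactly $p$. Theorem. There is a polynomial-time algorithm that, given a positive integer $p$ and an oriented graph $D$ of order distinct from $p+1$, decides whether $D$ is $(=p)$-invertible. That is, there are a Turing machine and a polynomial $q$ such that on every input $(p, D)$ with $|V(D)| \neq p+1$, where $p \ge 1$ is written in binary and $D$ is given by its adjacency matrix, the machine halts after at most $q(\ell)$ steps, where $\ell$ is the length of the input string, and outputs whether $D$ is $(=p)$-invertible. -/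

import Mathlib

/-- An oriented graph on the vertex set `V`: a digraph without digons (and hence without loops). -/
structure OrientedGraph (V : Type*) extends Digraph V where
  /-- At most one of the arcs `uv` and `vu` is present. -/
  asymm : ∀ u v, Adj u v → ¬ Adj v u

namespace OrientedGraph

/-- The inversion of `X` in `D`: all arcs with both endvertices in `X` are reversed, and all other
arcs are kept. -/
def invert {V : Type*} (D : OrientedGraph V) (X : Finset V) : OrientedGraph V where
  Adj u v := (u ∈ X ∧ v ∈ X ∧ D.Adj v u) ∨ (¬ (u ∈ X ∧ v ∈ X) ∧ D.Adj u v)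
  asymm u v := by
    have h₁ := D.asymm u v
    have h₂ := D.asymm v u
    tauto

/-- The oriented graph obtained from `D` by inverting the members of a family, one after another. -/
def invertFamily {V : Type*} (D : OrientedGraph V) (F : List (Finset V)) : OrientedGraph V :=
  F.foldl invert D

/-- `D` is acyclic: there is no directed closed walk of positive length (equivalently, there is no
directed cycle). -/
def IsAcyclic {V : Type*} (D : OrientedGraph V) : Prop :=
  ∀ v, ¬ Relation.TransGen D.Adj v v

/-- `D` is `(=p)`-invertible: it can be made acyclic by inversions of sets of size exactly `p`
(any finite number of them, possibly none). -/
def IsEqInvertible {V : Type*} (p : ℕ) (D : OrientedGraph V) : Prop :=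
  ∃ F : List (Finset V), (∀ X ∈ F, X.card = p) ∧ (D.invertFamily F).IsAcyclic

end OrientedGraph

/-- An instance of the decision problem: a positive integer `p` and a finite oriented graph
(on `0, …, n - 1`) whose order `n` is distinct from `p + 1`. -/
structure EqInversionInstance where
  /-- The prescribed size of the inverted sets. -/
  p : ℕ
  /-- The order of the oriented graph. -/
  n : ℕ
  /-- The oriented graph. -/
  graph : OrientedGraph (Fin n)
  p_pos : 0 < p
  order_ne : n ≠ p + 1

namespace EqInversionInstance

open Computability in
open scoped Classical in
/-- The row of the vertex `u` in the adjacency matrix of `D`, as a string of bits. -/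
noncomputable def encodeRow {n : ℕ} (D : OrientedGraph (Fin n)) (u : Fin n) : List Γ' :=
  List.ofFn fun v => Γ'.bit (decide (D.Adj u v))

open Computability in
/-- The input string of an instance, over the standard Turing machine alphabet: the binary
expansion of `p`, then the rows of the adjacency matrix, each part being ended by a comma. -/
noncomputable def encode (I : EqInversionInstance) : List Γ' :=
  (encodeNat I.p).map Γ'.bit ++ Γ'.comma ::
    (List.finRange I.n).flatMap fun u => encodeRow I.graph u ++ [Γ'.comma]

open scoped Classical in
/-- The correct answer: whether the oriented graph of the instance is `(=p)`-invertible. -/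
noncomputable def answer (I : EqInversionInstance) : Bool :=
  decide (I.graph.IsEqInvertible I.p)

end EqInversionInstance

/-!
Inverting `X` reverses the arcs in the clique on `X`. Hence, over the field with two elements, the
orientations reachable from `D` are those whose set of reversed arcs agrees on the arcs of `D` with
an element of the span of the cliques on `p` vertices.

Let `n ≥ p + 2`. Exchanging vertices of a clique one at a time shows that this span contains all
`4`-cycles. If `p` is even, it then contains the sums of any two edges, so that of any two sets
of edges differing in one edge at least one lies in the span; if `p` is odd, the same holds for
triangles and the cycle space. Inverting the first `2` or `3` vertices of an acyclic ordering only
permutes them, so the class outside the span can be corrected and does no harm. Hence `D` is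
always invertible if `p` is even. If `p` is odd, `D` is invertible if and only if some ordering of
the vertices is such that its forward arcs, together with some pairs that are not joined by an arc,
form a graph with all degrees even.

Such pairs can be found if and only if the degrees have an even sum in every component of the
complement of the underlying graph of `D`. Up to a parity that does not depend on the ordering, this
sum is the number of vertices of the component in odd positions. So the `⌊n / 2⌋` odd positions have
to be distributed to the components with prescribed parities, which is possible if and only if
neither the odd parities nor the parities of the complementary distribution are too numerous: two
inequalities between numbers of components. Finally, if `p = 1` or `n ≤ p`, inversions do not affect
acyclicity.

These conditions are Boolean queries about the adjacency matrix, built by folding over the vertices,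
counting vertices, and iterating an operator on sets of vertices `n` times; a query of this kind
runs in polynomial time on a machine that keeps numbers in unary on its stacks.
-/

/-! ### Sums of cliques -/

namespace OrientedGraph

open Finset

section CharTwo

theorem zmod_two_eq_zero_or_one (c : ZMod 2) : c = 0 ∨ c = 1 := by
  revert c
  decide

variable {M : Type*} [AddCommGroup M] [Module (ZMod 2) M] {W : Submodule (ZMod 2) M}

theorem add_mem_trans {S T U : M} (hST : S + T ∈ W) (hTU : T + U ∈ W) : S + U ∈ W := by
  have h := add_mem hST hTU
  rwa [add_assoc, ← add_assoc T, ZModModule.add_self, zero_add] at h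

theorem mem_or_add_mem {G : Set M} {S T : M} (hG : ∀ g ∈ G, g + T ∈ W)
    (hS : S ∈ Submodule.span (ZMod 2) G) : S ∈ W ∨ S + T ∈ W := by
  have hle : Submodule.span (ZMod 2) G ≤ W ⊔ Submodule.span (ZMod 2) {T} := by
    refine Submodule.span_le.mpr fun g hg => Submodule.mem_sup.mpr ⟨g + T, hG g hg, T,
      Submodule.mem_span_singleton_self T, ?_⟩
    rw [add_assoc, ZModModule.add_self, add_zero]
  obtain ⟨w, hw, t, ht, rfl⟩ := Submodule.mem_sup.mp (hle hS)
  obtain ⟨c, rfl⟩ := Submodule.mem_span_singleton.mp ht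
  obtain rfl | rfl := zmod_two_eq_zero_or_one c
  · simpa using Or.inl hw
  · right
    rwa [one_smul, add_assoc, ZModModule.add_self, add_zero]

end CharTwo

section Clique

variable {V : Type*} [DecidableEq V]

/-- The indicator function of a set of vertices, over the field with two elements. -/
def ind (X : Finset V) (x : V) : ZMod 2 := if x ∈ X then 1 else 0

/-- The edge set of the complete graph on `X`, as a matrix over the field with two elements. -/
def clique (X : Finset V) (x y : V) : ZMod 2 := if x = y then 0 else ind X x * ind X y

/-- The edge `ab` as a matrix over the field with two elements; it vanishes if `a = b`. -/
def edge (a b x y : V) : ZMod 2 := ind {a} x * ind {b} y + ind {b} x * ind {a} y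

/-- The triangle `abc` as a matrix over the field with two elements. -/
def triangle (a b c : V) : V → V → ZMod 2 := edge a b + edge b c + edge c a

theorem ind_insert {a : V} {X : Finset V} (h : a ∉ X) (x : V) :
    ind (insert a X) x = ind X x + ind {a} x := by
  by_cases hx : x = a
  · simp [ind, hx, h]
  · simp [ind, hx]

theorem ind_insert_insert {a b : V} {X : Finset V} (hab : a ≠ b) (ha : a ∉ X) (hb : b ∉ X)
    (x : V) : ind (insert a (insert b X)) x = ind X x + ind {b} x + ind {a} x := by
  rw [ind_insert (by simp [hab, ha]), ind_insert hb]

theorem ind_singleton_mul_of_ne {a x y : V} (h : x ≠ y) : ind {a} x * ind {a} y = 0 := by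
  by_cases hx : x = a
  · simp [ind, ← hx, h.symm]
  · simp [ind, hx]

theorem sum_ind_singleton (X : Finset V) (x : V) : ∑ a ∈ X, ind {a} x = ind X x := by
  simp [ind]

theorem edge_comm (a b : V) : edge a b = edge b a := by
  funext x y
  exact add_comm _ _

theorem edge_self (a : V) : edge a a = 0 := by
  funext x y
  exact CharTwo.add_self_eq_zero _

theorem clique_pair {a b : V} (h : a ≠ b) : clique {a, b} = edge a b := by
  funext x y
  simp only [clique, edge, ind, mem_insert, mem_singleton]
  grind

theorem clique_triple {a b c : V} (hab : a ≠ b) (hac : a ≠ c) (hbc : b ≠ c) :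
    clique {a, b, c} = triangle a b c := by
  funext x y
  simp only [clique, triangle, edge, ind, mem_insert, mem_singleton, Pi.add_apply]
  grind

theorem edge_apply_comm (a b x y : V) : edge a b x y = edge a b y x := by
  simp only [edge]
  ring

theorem edge_apply_self (a b x : V) : edge a b x x = 0 := by
  rw [edge, mul_comm, CharTwo.add_self_eq_zero]

theorem clique_apply_self (X : Finset V) (x : V) : clique X x x = 0 := if_pos rfl

theorem clique_apply_comm (X : Finset V) (x y : V) : clique X x y = clique X y x := by
  simp only [clique, mul_comm, eq_comm]

theorem triangle_swap (a b c : V) : triangle a b c = triangle a c b := by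
  rw [triangle, triangle, edge_comm a b, edge_comm b c, edge_comm c a]
  abel

theorem triangle_self_left (a b : V) : triangle a a b = 0 := by
  rw [triangle, edge_self, zero_add, edge_comm b a, ZModModule.add_self]

theorem sum_clique_apply [Fintype V] (X : Finset V) (x : V) :
    ∑ y, clique X x y = ind X x * (X.card - 1) := by
  have hcard : ∑ y, ind X y = X.card := by simp [ind]
  have hsq : ind X x * ind X x = ind X x := by simp [ind]
  have hdiag : ∀ y, clique X x y = ind X x * ind X y - if x = y then ind X x * ind X y else 0 := by
    intro y
    rw [clique]
    split_ifs <;> simp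
  simp only [hdiag, sum_sub_distrib, ← mul_sum, hcard, sum_ite_eq, mem_univ, if_true, hsq]
  ring

/-- The space of edge sets of graphs on `V`: symmetric matrices with zero diagonal. -/
def edgeSpace (V : Type*) : Submodule (ZMod 2) (V → V → ZMod 2) where
  carrier := {S | (∀ x y, S x y = S y x) ∧ ∀ x, S x x = 0}
  zero_mem' := by simp
  add_mem' := by
    rintro S T ⟨hS, hS'⟩ ⟨hT, hT'⟩
    exact ⟨fun x y => congrArg₂ (· + ·) (hS x y) (hT x y), fun x => by simp [hS', hT']⟩
  smul_mem' := by
    rintro c S ⟨hS, hS'⟩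
    exact ⟨fun x y => congrArg (c * ·) (hS x y), fun x => by simp [hS']⟩

/-- The cycle space of the complete graph on `V`: edge sets of graphs with all degrees even. -/
def cycleSpace (V : Type*) [Fintype V] : Submodule (ZMod 2) (V → V → ZMod 2) where
  carrier := {S | S ∈ edgeSpace V ∧ ∀ x, ∑ y, S x y = 0}
  zero_mem' := by simp
  add_mem' := by
    rintro S T ⟨hS, hS'⟩ ⟨hT, hT'⟩
    exact ⟨add_mem hS hT, fun x => by simp [sum_add_distrib, hS', hT']⟩
  smul_mem' := by
    rintro c S ⟨hS, hS'⟩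
    exact ⟨Submodule.smul_mem _ c hS, fun x => by simp [← mul_sum, hS']⟩

/-- The sums of complete graphs on `p` vertices. -/
def cliqueSpan (V : Type*) [DecidableEq V] (p : ℕ) : Submodule (ZMod 2) (V → V → ZMod 2) :=
  Submodule.span (ZMod 2) {S | ∃ X : Finset V, X.card = p ∧ clique X = S}

theorem clique_mem_cliqueSpan {p : ℕ} {X : Finset V} (h : X.card = p) :
    clique X ∈ cliqueSpan V p :=
  Submodule.subset_span ⟨X, h, rfl⟩

theorem clique_mem_edgeSpace (X : Finset V) : clique X ∈ edgeSpace V :=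
  ⟨clique_apply_comm X, clique_apply_self X⟩

theorem cliqueSpan_le_cycleSpace [Fintype V] {p : ℕ} (hp : Odd p) :
    cliqueSpan V p ≤ cycleSpace V := by
  rw [cliqueSpan, Submodule.span_le]
  rintro _ ⟨X, rfl, rfl⟩
  refine ⟨clique_mem_edgeSpace X, fun x => ?_⟩
  rw [sum_clique_apply, ZMod.natCast_eq_one_iff_odd.mpr hp, sub_self, mul_zero]

theorem exists_disjoint_card {α : Type*} [Fintype α] (A : Finset α) {k : ℕ}
    (h : A.card + k ≤ Fintype.card α) : ∃ Y : Finset α, Y.card = k ∧ Disjoint A Y := by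
  classical
  obtain ⟨Y, hY, hk⟩ := exists_subset_card_eq (s := Aᶜ) (n := k) (by rw [card_compl]; lia)
  exact ⟨Y, hk, disjoint_compl_right.mono_right hY⟩

theorem clique_insert_insert_mem {p : ℕ} (hp : 2 ≤ p) {Y : Finset V} (hY : Y.card = p - 2)
    {u v : V} (huv : u ≠ v) (hu : u ∉ Y) (hv : v ∉ Y) :
    clique (insert u (insert v Y)) ∈ cliqueSpan V p := by
  refine clique_mem_cliqueSpan ?_
  rw [card_insert_of_notMem (by simp [huv, hu]), card_insert_of_notMem hv]
  lia

theorem sum_square_apply {Z : Finset V} (hZ : Even Z.card) (a b c x y : V) :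
    (∑ z ∈ Z, (edge a b + edge b c + edge c z + edge z a)) x y =
      ind Z x * (ind {a} y + ind {c} y) + ind Z y * (ind {a} x + ind {c} x) := by
  have hcard : (Z.card : ZMod 2) = 0 := ZMod.natCast_eq_zero_iff_even.mpr hZ
  simp only [Finset.sum_apply, Pi.add_apply, sum_add_distrib, sum_const, nsmul_eq_mul, hcard,
    zero_mul, edge, ← mul_sum, ← sum_mul, sum_ind_singleton]
  ring

variable [Fintype V] {p : ℕ}

theorem square_mem_cliqueSpan (hp : 2 ≤ p) (hV : p + 2 ≤ Fintype.card V) {a b c d : V}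
    (hab : a ≠ b) (had : a ≠ d) (hbc : b ≠ c) (hcd : c ≠ d) :
    edge a b + edge b c + edge c d + edge d a ∈ cliqueSpan V p := by
  obtain ⟨Y, hY, hdisj⟩ := exists_disjoint_card {a, b, c, d} (k := p - 2)
    (by have := card_le_four (a := a) (b := b) (c := c) (d := d); lia)
  simp only [disjoint_insert_left, disjoint_singleton_left] at hdisj
  obtain ⟨ha, hb, hc, hd⟩ := hdisj
  have sum_cliques : edge a b + edge b c + edge c d + edge d a =
      clique (insert a (insert b Y)) + clique (insert b (insert c Y)) +
        clique (insert c (insert d Y)) + clique (insert d (insert a Y)) := by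
    funext x y
    simp only [Pi.add_apply]
    by_cases hxy : x = y
    · simp only [hxy, edge_apply_self, clique_apply_self]
    · simp only [clique, if_neg hxy, ind_insert_insert hab ha hb, ind_insert_insert hbc hb hc,
        ind_insert_insert hcd hc hd, ind_insert_insert had.symm hd ha, edge]
      linear_combination (-(2 * ind Y x * ind Y y) -
        ind Y x * (ind {a} y + ind {b} y + ind {c} y + ind {d} y) -
        ind Y y * (ind {a} x + ind {b} x + ind {c} x + ind {d} x) -
        (ind {a} x * ind {a} y + ind {b} x * ind {b} y + ind {c} x * ind {c} y +
          ind {d} x * ind {d} y)) * CharTwo.two_eq_zero (R := ZMod 2)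
  rw [sum_cliques]
  exact add_mem (add_mem (add_mem (clique_insert_insert_mem hp hY hab ha hb)
    (clique_insert_insert_mem hp hY hbc hb hc)) (clique_insert_insert_mem hp hY hcd hc hd))
    (clique_insert_insert_mem hp hY had.symm hd ha)

theorem path_mem_cliqueSpan (hp : 2 ≤ p) (hV : p + 2 ≤ Fintype.card V) (heven : Even p)
    {a b c : V} (hab : a ≠ b) (hbc : b ≠ c) : edge a b + edge b c ∈ cliqueSpan V p := by
  obtain ⟨Z, hZ, hdisj⟩ := exists_disjoint_card {a, b, c} (k := p - 2)
    (by have := card_le_three (a := a) (b := b) (c := c); lia)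
  simp only [disjoint_insert_left, disjoint_singleton_left] at hdisj
  obtain ⟨ha, hb, hc⟩ := hdisj
  have hZeven : Even Z.card := by rw [hZ]; exact heven.tsub even_two
  have path_eq : edge a b + edge b c =
      clique (insert a (insert b Z)) + clique (insert c (insert b Z)) +
        ∑ z ∈ Z, (edge a b + edge b c + edge c z + edge z a) := by
    funext x y
    rw [Pi.add_apply, Pi.add_apply, Pi.add_apply, Pi.add_apply, Pi.add_apply, Pi.add_apply,
      sum_square_apply hZeven]
    by_cases hxy : x = y
    · simp only [hxy, edge_apply_self, clique_apply_self, CharTwo.add_self_eq_zero]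
    · simp only [clique, if_neg hxy, ind_insert_insert hab ha hb, ind_insert_insert hbc.symm hc hb,
        edge]
      linear_combination -(ind Z x * ind Z y + ind Z x * (ind {a} y + ind {b} y + ind {c} y) +
        ind Z y * (ind {a} x + ind {b} x + ind {c} x) + ind {b} x * ind {b} y) *
          CharTwo.two_eq_zero (R := ZMod 2) -
        ind_singleton_mul_of_ne (a := a) hxy - ind_singleton_mul_of_ne (a := c) hxy
  rw [path_eq]
  refine add_mem (add_mem (clique_insert_insert_mem hp hZ hab ha hb)
    (clique_insert_insert_mem hp hZ hbc.symm hc hb))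
    (sum_mem fun z hz => square_mem_cliqueSpan hp hV hab ?_ hbc ?_)
  · exact (ne_of_mem_of_not_mem hz ha).symm
  · exact (ne_of_mem_of_not_mem hz hc).symm

theorem edge_add_edge_mem (hp : 2 ≤ p) (hV : p + 2 ≤ Fintype.card V) (heven : Even p)
    {a b c d : V} (hab : a ≠ b) (hcd : c ≠ d) : edge a b + edge c d ∈ cliqueSpan V p := by
  by_cases hbc : b = c
  · subst hbc
    exact path_mem_cliqueSpan hp hV heven hab hcd
  · exact add_mem_trans (path_mem_cliqueSpan hp hV heven hab hbc)
      (path_mem_cliqueSpan hp hV heven hbc hcd)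

theorem triangle_add_triangle_mem (hp : 2 ≤ p) (hV : p + 2 ≤ Fintype.card V) {a b c d e : V}
    (hab : a ≠ b) (hac : a ≠ c) (hbc : b ≠ c) (had : a ≠ d) (hae : a ≠ e) (hde : d ≠ e) :
    triangle a b c + triangle a d e ∈ cliqueSpan V p := by
  have common_edge : ∀ {b c d : V}, a ≠ b → a ≠ d → b ≠ c → d ≠ c →
      triangle a b c + triangle a d c ∈ cliqueSpan V p := by
    intro b c d hab had hbc hdc
    have : triangle a b c + triangle a d c = edge a b + edge b c + edge c d + edge d a := by
      rw [triangle, triangle, edge_comm c d, edge_comm d a]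
      linear_combination (exp := 1) ZModModule.add_self (edge c a)
    rw [this]
    exact square_mem_cliqueSpan hp hV hab had hbc hdc.symm
  by_cases hcd : c = d
  · subst hcd
    rw [triangle_swap a c e]
    exact common_edge hab hae hbc hde.symm
  · refine add_mem_trans (common_edge hab had hbc (Ne.symm hcd)) ?_
    rw [triangle_swap a d c, triangle_swap a d e]
    exact common_edge hac hae hcd hde.symm

end Clique

section Generators

variable {V : Type*} [Fintype V] [LinearOrder V]

theorem sum_lt_add_swap {M : Type*} [AddCommMonoid M] (F : V → V → M) (hF : ∀ x, F x x = 0) :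
    ∑ e : V × V with e.1 < e.2, (F e.1 e.2 + F e.2 e.1) = ∑ x, ∑ y, F x y := by
  have hswap : ∑ e : V × V with e.1 < e.2, F e.2 e.1 = ∑ e : V × V with e.2 < e.1, F e.1 e.2 :=
    sum_equiv (Equiv.prodComm V V) (by simp) (by simp)
  rw [sum_add_distrib, hswap, sum_filter, sum_filter, ← sum_add_distrib, Fintype.sum_prod_type]
  refine sum_congr rfl fun x _ => sum_congr rfl fun y _ => ?_
  rcases lt_trichotomy x y with h | rfl | h
  · simp [h, h.not_gt]
  · simp [hF]
  · simp [h, h.not_gt]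

theorem sum_smul_edge {S : V → V → ZMod 2} (hS : S ∈ edgeSpace V) :
    ∑ e : V × V with e.1 < e.2, S e.1 e.2 • edge e.1 e.2 = S := by
  let F (u v : V) : V → V → ZMod 2 := fun x y => S u v * (ind {u} x * ind {v} y)
  have hF : ∀ u v, S u v • edge u v = F u v + F v u := by
    intro u v
    funext x y
    simp only [Pi.smul_apply, smul_eq_mul, edge, Pi.add_apply, F, hS.1 v u]
    ring
  have hF₀ : ∀ u, F u u = 0 := by
    intro u
    funext x y
    simp only [F, hS.2, zero_mul, Pi.zero_apply]
  simp only [hF]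
  rw [sum_lt_add_swap F hF₀]
  funext x y
  simp [F, ind, Finset.sum_apply]

theorem edgeSpace_le_span {V : Type*} [Finite V] [LinearOrder V] :
    edgeSpace V ≤ Submodule.span (ZMod 2) {T | ∃ u v : V, u ≠ v ∧ edge u v = T} := by
  cases nonempty_fintype V
  intro S hS
  rw [← sum_smul_edge hS]
  refine sum_mem fun e he => Submodule.smul_mem _ _ (Submodule.subset_span ⟨e.1, e.2, ?_, rfl⟩)
  exact (mem_filter.mp he).2.ne

theorem sum_smul_triangle (a : V) {S : V → V → ZMod 2} (hS : S ∈ cycleSpace V) :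
    ∑ e : V × V with e.1 < e.2, S e.1 e.2 • triangle a e.1 e.2 = S := by
  have hstar : ∑ e : V × V with e.1 < e.2,
      (S e.1 e.2 • edge a e.1 + S e.2 e.1 • edge a e.2) = 0 := by
    rw [sum_lt_add_swap (fun u v => S u v • edge a u) fun u => by rw [hS.1.2, zero_smul]]
    simp only [← sum_smul, hS.2, zero_smul, sum_const_zero]
  have hsplit : ∀ e : V × V, S e.1 e.2 • triangle a e.1 e.2 =
      S e.1 e.2 • edge e.1 e.2 + (S e.1 e.2 • edge a e.1 + S e.2 e.1 • edge a e.2) := by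
    intro e
    rw [triangle, edge_comm e.2 a, hS.1.1 e.2 e.1, smul_add, smul_add]
    abel
  simp only [hsplit]
  rw [sum_add_distrib, hstar, add_zero, sum_smul_edge hS.1]

theorem cycleSpace_le_span (a : V) :
    cycleSpace V ≤ Submodule.span (ZMod 2)
      {T | ∃ u v : V, a ≠ u ∧ a ≠ v ∧ u ≠ v ∧ triangle a u v = T} := by
  intro S hS
  rw [← sum_smul_triangle a hS]
  refine sum_mem fun e he => Submodule.smul_mem _ _ ?_
  by_cases h₁ : a = e.1
  · rw [← h₁, triangle_self_left]
    exact zero_mem _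
  by_cases h₂ : a = e.2
  · rw [← h₂, triangle_swap, triangle_self_left]
    exact zero_mem _
  exact Submodule.subset_span ⟨e.1, e.2, h₁, h₂, (mem_filter.mp he).2.ne, rfl⟩

variable {p : ℕ} {S : V → V → ZMod 2} {X : Finset V}

theorem mem_or_add_clique_mem_of_even (hp : 2 ≤ p) (hV : p + 2 ≤ Fintype.card V) (heven : Even p)
    (hS : S ∈ edgeSpace V) (hX : X.card = 2) :
    S ∈ cliqueSpan V p ∨ S + clique X ∈ cliqueSpan V p := by
  obtain ⟨c, d, hcd, rfl⟩ := card_eq_two.mp hX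
  rw [clique_pair hcd]
  refine mem_or_add_mem ?_ (edgeSpace_le_span hS)
  rintro _ ⟨u, v, huv, rfl⟩
  exact edge_add_edge_mem hp hV heven huv hcd

theorem mem_or_add_clique_mem_of_mem_cycleSpace (hp : 2 ≤ p) (hV : p + 2 ≤ Fintype.card V)
    (hS : S ∈ cycleSpace V) (hX : X.card = 3) :
    S ∈ cliqueSpan V p ∨ S + clique X ∈ cliqueSpan V p := by
  obtain ⟨a, b, c, hab, hac, hbc, rfl⟩ := card_eq_three.mp hX
  rw [clique_triple hab hac hbc]
  refine mem_or_add_mem ?_ (cycleSpace_le_span a hS)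
  rintro _ ⟨u, v, hu, hv, huv, rfl⟩
  exact triangle_add_triangle_mem hp hV hu hv huv hab hac hbc

end Generators

/-! ### Orientations up to inversion -/

section Flip

variable {V : Type*}

/-- The adjacency relation obtained from `D` by reversing the arcs in the support of `S`. -/
def FlipAdj (D : OrientedGraph V) (S : V → V → ZMod 2) (u v : V) : Prop :=
  (S u v = 0 ∧ D.Adj u v) ∨ (S u v = 1 ∧ D.Adj v u)

theorem not_adj_self (D : OrientedGraph V) (u : V) : ¬ D.Adj u u := fun h => D.asymm u u h h

theorem invert_flipAdj [DecidableEq V] (D : OrientedGraph V) (X : Finset V)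
    (S : V → V → ZMod 2) : (D.invert X).FlipAdj S = D.FlipAdj (clique X + S) := by
  funext u v
  by_cases huv : u = v
  · subst huv
    simp [FlipAdj, invert, D.not_adj_self]
  · have := D.asymm u v
    rcases zmod_two_eq_zero_or_one (S u v) with h | h <;>
      by_cases hu : u ∈ X <;> by_cases hv : v ∈ X <;>
        simp [FlipAdj, invert, clique, ind, h, hu, hv, huv, CharTwo.add_self_eq_zero]

theorem invertFamily_adj [DecidableEq V] (D : OrientedGraph V) (F : List (Finset V)) :
    (D.invertFamily F).Adj = D.FlipAdj (F.map clique).sum := by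
  induction F generalizing D with
  | nil =>
    funext u v
    simp [invertFamily, FlipAdj]
  | cons X F ih =>
    rw [List.map_cons, List.sum_cons, ← invert_flipAdj]
    exact ih (D.invert X)

theorem exists_sum_clique_eq [DecidableEq V] {p : ℕ} {S : V → V → ZMod 2}
    (hS : S ∈ cliqueSpan V p) :
    ∃ F : List (Finset V), (∀ X ∈ F, X.card = p) ∧ (F.map clique).sum = S := by
  induction hS using Submodule.span_induction with
  | mem S hS =>
    obtain ⟨X, hX, rfl⟩ := hS
    exact ⟨[X], by simpa using hX, by simp⟩
  | zero => exact ⟨[], by simp, rfl⟩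
  | add S T _ _ hS hT =>
    obtain ⟨F, hF, rfl⟩ := hS
    obtain ⟨G, hG, rfl⟩ := hT
    exact ⟨F ++ G, by simpa [or_imp, forall_and] using ⟨hF, hG⟩, by simp⟩
  | smul c S _ hS =>
    rcases zmod_two_eq_zero_or_one c with rfl | rfl
    · exact ⟨[], by simp, by simp⟩
    · simpa using hS

theorem isEqInvertible_iff_exists_mem_cliqueSpan [DecidableEq V] {p : ℕ} {D : OrientedGraph V} :
    D.IsEqInvertible p ↔
      ∃ S ∈ cliqueSpan V p, ∀ v, ¬ Relation.TransGen (D.FlipAdj S) v v := by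
  constructor
  · rintro ⟨F, hF, h⟩
    refine ⟨(F.map clique).sum, list_sum_mem ?_, by rwa [← invertFamily_adj]⟩
    simpa using fun X hX => clique_mem_cliqueSpan (hF X hX)
  · rintro ⟨S, hS, h⟩
    obtain ⟨F, hF, rfl⟩ := exists_sum_clique_eq hS
    exact ⟨F, hF, by rwa [IsAcyclic, invertFamily_adj]⟩

theorem not_transGen_of_lt {R : V → V → Prop} {σ : V → ℕ} (h : ∀ u v, R u v → σ v < σ u)
    (v : V) : ¬ Relation.TransGen R v v := by
  have hlt : ∀ {u w}, Relation.TransGen R u w → σ w < σ u := by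
    intro u w huw
    induction huw with
    | single huv => exact h _ _ huv
    | tail _ hvw ih => exact (h _ _ hvw).trans ih
  exact fun hv => lt_irrefl _ (hlt hv)

theorem exists_equiv_fin_of_not_transGen [Fintype V] {R : V → V → Prop}
    (h : ∀ v, ¬ Relation.TransGen R v v) :
    ∃ σ : V ≃ Fin (Fintype.card V), ∀ u v, R u v → σ v < σ u := by
  classical
  let r : V → V → Prop := fun u v => Relation.ReflTransGen R v u
  have : IsPartialOrder V r :=
    { refl := fun _ => Relation.ReflTransGen.refl
      trans := fun _ _ _ h₁ h₂ => h₂.trans h₁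
      antisymm := by
        intro u v h₁ h₂
        by_contra huv
        rcases Relation.reflTransGen_iff_eq_or_transGen.mp h₁ with h₁ | h₁
        · exact huv h₁
        · exact h v (h₁.trans_left h₂) }
  obtain ⟨s, hs, hrs⟩ := extend_partialOrder r
  let : LinearOrder V :=
    { le := s
      le_refl := hs.refl
      le_trans := hs.trans
      le_antisymm := hs.antisymm
      le_total := hs.total
      toDecidableLE := Classical.decRel _ }
  let e := (Fintype.orderIsoFinOfCardEq V rfl).symm
  refine ⟨e.toEquiv, fun u v huv => e.lt_iff_lt.mpr (lt_of_le_of_ne ?_ ?_)⟩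
  · exact hrs v u (Relation.ReflTransGen.single huv)
  · rintro rfl
    exact h v (Relation.TransGen.single huv)

/-- The graph in which two vertices are adjacent if there is no arc between them. -/
def complGraph (D : OrientedGraph V) : SimpleGraph V where
  Adj u v := u ≠ v ∧ ¬ D.Adj u v ∧ ¬ D.Adj v u
  symm := ⟨fun _ _ h => ⟨h.1.symm, h.2.2, h.2.1⟩⟩
  loopless := ⟨fun _ h => h.1 rfl⟩

open scoped Classical in
/-- The arcs of `D` that go from an earlier to a later vertex of the order `σ`; these have to be
flipped to make all arcs go backwards. -/
noncomputable def mismatch {α : Type*} [LT α] (D : OrientedGraph V) (σ : V → α) (u v : V) :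
    ZMod 2 :=
  if (D.Adj u v ∧ σ u < σ v) ∨ (D.Adj v u ∧ σ v < σ u) then 1 else 0

section Mismatch

variable {α : Type*} [LinearOrder α] {D : OrientedGraph V} {σ : V → α} {S : V → V → ZMod 2}

theorem mismatch_mem_edgeSpace (D : OrientedGraph V) (σ : V → α) : D.mismatch σ ∈ edgeSpace V :=
  ⟨fun u v => by unfold mismatch; split_ifs <;> tauto, fun u => by simp [mismatch]⟩

open scoped Classical in
theorem mismatch_add_lt (hσ : σ.Injective) {u v : V} (h : ¬ D.complGraph.Adj u v) :
    D.mismatch σ u v + (if σ v < σ u then 1 else 0) = if D.Adj u v then 1 else 0 := by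
  by_cases huv : u = v
  · subst huv
    simp [mismatch, D.not_adj_self]
  have h₁ := D.asymm u v
  have h₂ : D.Adj u v ∨ D.Adj v u := by simp [complGraph, huv] at h; tauto
  rcases lt_or_gt_of_ne (hσ.ne huv) with hlt | hlt <;> rcases h₂ with h₂ | h₂ <;>
    simp_all [mismatch, hlt.not_gt, CharTwo.add_self_eq_zero]

theorem forall_flipAdj_lt_iff (hσ : σ.Injective) (hS : S ∈ edgeSpace V) :
    (∀ u v, D.FlipAdj S u v → σ v < σ u) ↔
      ∀ u v, ¬ D.complGraph.Adj u v → S u v = D.mismatch σ u v := by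
  constructor
  · intro h
    have eq_of_adj : ∀ u v, D.Adj u v → S u v = D.mismatch σ u v := by
      intro u v huv
      have hvu := D.asymm u v huv
      rcases zmod_two_eq_zero_or_one (S u v) with hs | hs
      · simp [mismatch, hs, hvu, (h u v (Or.inl ⟨hs, huv⟩)).not_gt]
      · simp [mismatch, hs, huv, h v u (Or.inr ⟨hS.1 u v ▸ hs, huv⟩)]
    intro u v huv
    by_cases hne : u = v
    · rw [hne, hS.2, (D.mismatch_mem_edgeSpace σ).2]
    by_cases h₁ : D.Adj u v
    · exact eq_of_adj u v h₁
    · rw [hS.1, (D.mismatch_mem_edgeSpace σ).1]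
      exact eq_of_adj v u (by_contra fun h₂ => huv ⟨hne, h₁, h₂⟩)
  · rintro h u v (⟨hs, huv⟩ | ⟨hs, hvu⟩)
    · have hne : u ≠ v := by rintro rfl; exact D.not_adj_self u huv
      rw [h u v fun hc => hc.2.1 huv] at hs
      simp only [mismatch, huv, true_and, ite_eq_right_iff, one_ne_zero, imp_false] at hs
      exact (hσ.ne hne).lt_or_gt.resolve_left fun hlt => hs (Or.inl hlt)
    · rw [h u v fun hc => hc.2.2 hvu] at hs
      simpa [mismatch, hvu, D.asymm v u hvu] using hs

end Mismatch

theorem card_filter_equiv_fin_lt [Fintype V] (σ : V ≃ Fin (Fintype.card V)) {k : ℕ}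
    (hk : k ≤ Fintype.card V) : (univ.filter fun u => (σ u : ℕ) < k).card = k := by
  rw [card_equiv (t := univ.filter fun i : Fin (Fintype.card V) => (i : ℕ) < k) σ (by simp),
    Fin.card_filter_val_lt, min_eq_right hk]

variable [DecidableEq V] {D : OrientedGraph V} {S : V → V → ZMod 2}

/-- Inverting an initial segment of an acyclic ordering amounts to reversing it in the ordering. -/
theorem not_transGen_flipAdj_add_clique [Fintype V] (hS : S ∈ edgeSpace V) {σ : V → ℕ}
    (hσ : ∀ u v, D.FlipAdj S u v → σ v < σ u) (k : ℕ) (v : V) :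
    ¬ Relation.TransGen (D.FlipAdj (S + clique {u | σ u < k})) v v := by
  refine not_transGen_of_lt (σ := fun u => if σ u < k then k - 1 - σ u else σ u) ?_ v
  intro u v huv
  rcases zmod_two_eq_zero_or_one (clique {u | σ u < k} u v) with hT | hT
  · have hlt := hσ u v (by simpa [FlipAdj, hT] using huv)
    by_cases hu : σ u < k
    · have hne : u ≠ v := by rintro rfl; exact lt_irrefl _ hlt
      simp [clique, ind, hne, hu, hlt.trans hu] at hT
    · split_ifs <;> lia
  · have hlt : σ u < σ v := by
      refine hσ v u ?_
      rcases zmod_two_eq_zero_or_one (S u v) with hs | hs <;>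
        simpa [FlipAdj, hT, hs, hS.1 v u, CharTwo.add_self_eq_zero] using huv
    have hv : σ v < k := by
      by_contra hv
      simp [clique, ind, hv] at hT
    simp only [hlt.trans hv, hv, if_true]
    lia

theorem isEqInvertible_of_mem_or_add_clique_mem [Fintype V] {p k : ℕ} (hk : k ≤ Fintype.card V)
    (hS : S ∈ edgeSpace V) (σ : V ≃ Fin (Fintype.card V))
    (hσ : ∀ u v, D.FlipAdj S u v → σ v < σ u)
    (h : ∀ X : Finset V, X.card = k → S ∈ cliqueSpan V p ∨ S + clique X ∈ cliqueSpan V p) :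
    D.IsEqInvertible p := by
  rw [isEqInvertible_iff_exists_mem_cliqueSpan]
  rcases h _ (card_filter_equiv_fin_lt σ hk) with h | h
  · exact ⟨_, h, not_transGen_of_lt (σ := fun v => (σ v : ℕ)) hσ⟩
  · exact ⟨_, h, not_transGen_flipAdj_add_clique hS hσ k⟩

end Flip

section Invertible

variable {V : Type*} [Fintype V] [LinearOrder V] {p : ℕ}

theorem isEqInvertible_of_even (hp : 2 ≤ p) (heven : Even p) (hV : p + 2 ≤ Fintype.card V)
    (D : OrientedGraph V) : D.IsEqInvertible p := by
  let σ := Fintype.equivFin V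
  have hS := D.mismatch_mem_edgeSpace σ
  exact isEqInvertible_of_mem_or_add_clique_mem (k := 2) (by lia) hS σ
    ((forall_flipAdj_lt_iff σ.injective hS).mpr fun _ _ _ => rfl)
    fun X hX => mem_or_add_clique_mem_of_even hp hV heven hS hX

theorem isEqInvertible_iff_of_odd (hp : 3 ≤ p) (hodd : Odd p) (hV : p + 2 ≤ Fintype.card V)
    (D : OrientedGraph V) :
    D.IsEqInvertible p ↔ ∃ σ : V ≃ Fin (Fintype.card V), ∃ S ∈ cycleSpace V,
      ∀ u v, D.FlipAdj S u v → σ v < σ u := by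
  constructor
  · intro h
    obtain ⟨S, hS, h⟩ := isEqInvertible_iff_exists_mem_cliqueSpan.mp h
    obtain ⟨σ, hσ⟩ := exists_equiv_fin_of_not_transGen h
    exact ⟨σ, S, cliqueSpan_le_cycleSpace hodd hS, hσ⟩
  · rintro ⟨σ, S, hS, hσ⟩
    exact isEqInvertible_of_mem_or_add_clique_mem (k := 3) (by lia) hS.1 σ hσ fun X hX =>
      mem_or_add_clique_mem_of_mem_cycleSpace (by lia) hV hS hX

end Invertible

/-! ### Sets and matrices with prescribed parities -/

section FiberParity

theorem natCast_card_filter_eq_one {ι : Type*} [Fintype ι] (a : ι → ZMod 2) :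
    (#{r | a r = 1} : ZMod 2) = ∑ r, a r := by
  rw [← sum_boole]
  refine sum_congr rfl fun r _ => ?_
  rcases zmod_two_eq_zero_or_one (a r) with h | h <;> simp [h]

variable {V ι : Type*} [DecidableEq ι] {κ : V → ι} {a : ι → ZMod 2}

/-- The parities of the intersections of `O` with the fibers of `κ`. -/
def fiberParity (κ : V → ι) (O : Finset V) (r : ι) : ZMod 2 := #{u ∈ O | κ u = r}

theorem fiberParity_compl [Fintype V] [DecidableEq V] (κ : V → ι) (O : Finset V) :
    fiberParity κ Oᶜ = fiberParity κ univ + fiberParity κ O := by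
  funext r
  have hcard : #{u | κ u = r} = #{u ∈ O | κ u = r} + #{u ∈ Oᶜ | κ u = r} := by
    rw [← card_union_of_disjoint (disjoint_filter_filter disjoint_compl_right), ← filter_union,
      union_compl]
  rw [Pi.add_apply, fiberParity, fiberParity, fiberParity, hcard, Nat.cast_add,
    add_right_comm, CharTwo.add_self_eq_zero, zero_add]

theorem fiberParity_insert_insert [DecidableEq V] {u v : V} {O : Finset V} (huv : u ≠ v)
    (hu : u ∉ O) (hv : v ∉ O) (hκ : κ u = κ v) :
    fiberParity κ (insert u (insert v O)) = fiberParity κ O := by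
  funext r
  by_cases hr : κ v = r
  · simp only [fiberParity, filter_insert, hκ, hr, if_true]
    rw [card_insert_of_notMem (by simp [huv, hu]), card_insert_of_notMem (by simp [hv])]
    push_cast
    rw [add_assoc, CharTwo.add_self_eq_zero, add_zero]
  · simp [fiberParity, filter_insert, hκ, hr]

variable [Fintype ι]

theorem sum_fiberParity (κ : V → ι) (O : Finset V) : ∑ r, fiberParity κ O r = #O := by
  rw [card_eq_sum_card_fiberwise (f := κ) (t := univ) fun _ _ => mem_univ _, Nat.cast_sum]
  rfl

theorem card_fiberParity_eq_one_le (κ : V → ι) (O : Finset V) :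
    #{r | fiberParity κ O r = 1} ≤ #O := by
  rw [card_eq_sum_card_fiberwise (f := κ) (s := O) (t := univ) fun _ _ => mem_univ _, card_filter]
  refine sum_le_sum fun r _ => ?_
  split_ifs with h
  · rw [fiberParity, ZMod.natCast_eq_one_iff_odd] at h
    exact h.pos
  · exact Nat.zero_le _

theorem card_le_card_fiberParity_eq_one {O : Finset V} (h : ∀ r, #{u ∈ O | κ u = r} ≤ 1) :
    #O ≤ #{r | fiberParity κ O r = 1} := by
  rw [card_eq_sum_card_fiberwise (f := κ) (s := O) (t := univ) fun _ _ => mem_univ _, card_filter]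
  refine sum_le_sum fun r _ => ?_
  rcases Nat.le_one_iff_eq_zero_or_eq_one.mp (h r) with h | h <;> simp [fiberParity, h]

theorem exists_fiberParity_eq (h : ∀ r, a r = 1 → ∃ u, κ u = r) :
    ∃ O : Finset V, #O = #{r | a r = 1} ∧ fiberParity κ O = a := by
  have hsurj : Set.SurjOn κ Set.univ ({r | a r = 1} : Finset ι) :=
    fun r hr => (h r (by simpa using hr)).imp fun _ hu => ⟨trivial, hu⟩
  obtain ⟨O, -, hinj, himage⟩ := exists_subset_injOn_image_eq_of_surjOn _ _ hsurj
  refine ⟨O, by rw [← himage, card_image_of_injOn hinj], ?_⟩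
  funext r
  rcases zmod_two_eq_zero_or_one (a r) with hr | hr
  · have hempty : {u ∈ O | κ u = r} = ∅ := by
      refine filter_eq_empty_iff.mpr fun u hu hur => ?_
      have hmem : κ u ∈ O.image κ := mem_image_of_mem κ hu
      simp [himage, hur, hr] at hmem
    rw [fiberParity, hempty, hr, card_empty, Nat.cast_zero]
  · have hmem : r ∈ O.image κ := by simp [himage, hr]
    obtain ⟨u, hu, rfl⟩ := mem_image.mp hmem
    have hsingle : {v ∈ O | κ v = κ u} = {u} := by
      ext v
      simp only [mem_filter, mem_singleton]
      exact ⟨fun hv => hinj hv.1 hu hv.2, by rintro rfl; exact ⟨hu, rfl⟩⟩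
    rw [fiberParity, hsingle, hr, card_singleton, Nat.cast_one]

/-- Adding two elements of one fiber at a time, a set with fiber parities `a` grows until its
complement meets every fiber at most once. -/
theorem exists_card_eq_fiberParity_eq_iff [Fintype V] {m : ℕ} (hm : m ≤ Fintype.card V)
    (hsum : (m : ZMod 2) = ∑ r, a r) (ha : ∀ r, a r = 1 → ∃ u, κ u = r) :
    (∃ O : Finset V, #O = m ∧ fiberParity κ O = a) ↔
      #{r | a r = 1} ≤ m ∧ #{r | fiberParity κ univ r + a r = 1} ≤ Fintype.card V - m := by
  classical
  constructor
  · rintro ⟨O, rfl, rfl⟩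
    have h := card_fiberParity_eq_one_le κ Oᶜ
    rw [card_compl, fiberParity_compl] at h
    exact ⟨card_fiberParity_eq_one_le κ O, h⟩
  rintro ⟨hα, hβ⟩
  obtain ⟨O₀, hO₀, hκ₀⟩ := exists_fiberParity_eq ha
  obtain ⟨O, hO, hmax⟩ := exists_max_image
    ({O | fiberParity κ O = a ∧ #O ≤ m} : Finset (Finset V)) card ⟨O₀, by simp [hκ₀, hO₀, hα]⟩
  simp only [mem_filter, mem_univ, true_and, and_imp] at hO hmax
  obtain ⟨hκ, hle⟩ := hO
  refine ⟨O, hle.antisymm (not_lt.mp fun hlt => ?_), hκ⟩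
  have hpar : #O % 2 = m % 2 := by
    rw [← hκ, sum_fiberParity] at hsum
    exact ((ZMod.natCast_eq_natCast_iff' _ _ 2).mp hsum).symm
  have hsmall : ∀ r, #{u ∈ Oᶜ | κ u = r} ≤ 1 := by
    intro r
    by_contra! h
    obtain ⟨u, hu, v, hv, huv⟩ := one_lt_card.mp h
    simp only [mem_filter, mem_compl] at hu hv
    have hcard : #(insert u (insert v O)) = #O + 2 := by
      rw [card_insert_of_notMem (by simp [huv, hu.1]), card_insert_of_notMem hv.1]
    have := hmax (insert u (insert v O))
      ((fiberParity_insert_insert huv hu.1 hv.1 (hu.2.trans hv.2.symm)).trans hκ) (by lia)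
    lia
  have h := card_le_card_fiberParity_eq_one hsmall
  rw [card_compl, fiberParity_compl, hκ] at h
  exact absurd (h.trans hβ) (by lia)

end FiberParity

section Order

variable {V ι : Type*} [Fintype V] [DecidableEq ι]

theorem card_filter_fin_odd (n : ℕ) : #{i : Fin n | Odd (i : ℕ)} = n / 2 := by
  induction n using Nat.twoStepInduction with
  | zero => rfl
  | one => rfl
  | more n ih _ =>
    have hodd : ∀ i : ℕ, Odd (i + 1 + 1) ↔ Odd i := fun i => by simp [Nat.odd_add_one]
    simp only [Fin.card_filter_univ_succ', Fin.val_succ, Fin.val_zero, hodd, ih]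
    simp [add_comm]

theorem sum_fiber_eq_fiberParity (κ : V → ι) (f : V → ℕ) (r : ι) :
    ∑ u with κ u = r, (f u : ZMod 2) = fiberParity κ {u | Odd (f u)} r := by
  have h : ∀ k : ℕ, (k : ZMod 2) = if Odd k then 1 else 0 := by
    intro k
    split_ifs with hk
    · exact ZMod.natCast_eq_one_iff_odd.mpr hk
    · exact ZMod.natCast_eq_zero_iff_even.mpr (Nat.not_odd_iff_even.mp hk)
  simp only [h]
  rw [sum_boole, fiberParity, filter_comm]

theorem exists_equiv_fin_odd {O : Finset V} (hO : #O = Fintype.card V / 2) :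
    ∃ σ : V ≃ Fin (Fintype.card V), ({u | Odd (σ u : ℕ)} : Finset V) = O := by
  classical
  have hcard : Fintype.card {u // u ∈ O} =
      Fintype.card {u // Odd (Fintype.equivFin V u : ℕ)} := by
    rw [Fintype.card_coe, hO, ← card_filter_fin_odd, Fintype.card_subtype]
    exact (card_equiv (Fintype.equivFin V) (by simp)).symm
  let e := Fintype.equivOfCardEq hcard
  refine ⟨e.extendSubtype.trans (Fintype.equivFin V), ?_⟩
  ext u
  rw [mem_filter_univ]
  by_cases hu : u ∈ O
  · simpa [hu] using e.extendSubtype_mem u hu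
  · simpa [hu] using e.extendSubtype_not_mem u hu

theorem exists_equiv_fin_sum_fiber_eq_iff (κ : V → ι) (a : ι → ZMod 2) :
    (∃ σ : V ≃ Fin (Fintype.card V), ∀ r, ∑ u with κ u = r, ((σ u : ℕ) : ZMod 2) = a r) ↔
      ∃ O : Finset V, #O = Fintype.card V / 2 ∧ fiberParity κ O = a := by
  simp only [sum_fiber_eq_fiberParity, ← funext_iff]
  constructor
  · rintro ⟨σ, hσ⟩
    refine ⟨_, ?_, hσ⟩
    rw [← card_filter_fin_odd]
    exact card_equiv σ (by simp)
  · rintro ⟨O, hO, rfl⟩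
    obtain ⟨σ, rfl⟩ := exists_equiv_fin_odd hO
    exact ⟨σ, rfl⟩

theorem sum_boole_lt_eq (σ : V ≃ Fin (Fintype.card V)) (u : V) :
    ∑ v, (if σ v < σ u then 1 else 0 : ZMod 2) = (σ u : ℕ) := by
  rw [sum_boole, ← Fin.card_Iio]
  exact congrArg _ (card_equiv σ (by simp))

end Order

section Join

theorem sum_fiber_sum_eq_zero {V ι : Type*} [Fintype V] [LinearOrder V] [DecidableEq ι]
    {T : V → V → ZMod 2} (hT : T ∈ edgeSpace V) {κ : V → ι}
    (hκ : ∀ u v, κ u ≠ κ v → T u v = 0) (r : ι) :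
    ∑ u with κ u = r, ∑ v, T u v = 0 := by
  have hpush : ∑ u with κ u = r, ∑ v, T u v = ∑ u, ∑ v, if κ u = r then T u v else 0 := by
    rw [sum_filter]
    refine sum_congr rfl fun u _ => ?_
    split_ifs <;> simp
  rw [hpush, ← sum_lt_add_swap _ fun u => by simp [hT.2]]
  refine sum_eq_zero fun e _ => ?_
  rw [hT.1 e.2 e.1]
  by_cases h : κ e.1 = κ e.2
  · rw [h, CharTwo.add_self_eq_zero]
  · simp [hκ _ _ h]

variable {V : Type*} [Fintype V] [DecidableEq V]

theorem sum_edge_apply (a b x : V) : ∑ y, edge a b x y = ind {a} x + ind {b} x := by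
  have h : ∀ c : V, ∑ y, ind {c} y = (1 : ZMod 2) := by simp [ind]
  simp [edge, sum_add_distrib, ← mul_sum, h]

theorem exists_mem_edgeSpace_of_reachable {G : SimpleGraph V} {u w : V} (h : G.Reachable u w) :
    ∃ T ∈ edgeSpace V, (∀ x y, ¬ G.Adj x y → T x y = 0) ∧
      ∀ x, ∑ y, T x y = ind {u} x + ind {w} x := by
  obtain ⟨q⟩ := h
  induction q with
  | nil => exact ⟨0, zero_mem _, by simp, by simp [CharTwo.add_self_eq_zero]⟩
  | @cons u v w huv _ ih =>
    obtain ⟨T, hT, hG, hsum⟩ := ih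
    refine ⟨edge u v + T,
      add_mem ⟨edge_apply_comm u v, edge_apply_self u v⟩ hT, fun x y hxy => ?_, fun x => ?_⟩
    · have hedge : edge u v x y = 0 := by
        have := huv.symm
        simp only [edge, ind, mem_singleton]
        split_ifs <;> simp_all
      simp [hedge, hG x y hxy]
    · simp only [Pi.add_apply, sum_add_distrib, sum_edge_apply, hsum]
      linear_combination ind {v} x * CharTwo.two_eq_zero (R := ZMod 2)

/-- The sum of paths from each vertex `v` with `t v = 1` to the representative of its component. -/
theorem exists_mem_edgeSpace_sum_eq {G : SimpleGraph V} {κ : V → V}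
    (hκ : ∀ v, G.Reachable v (κ v)) {t : V → ZMod 2} (ht : ∀ r, ∑ v with κ v = r, t v = 0) :
    ∃ T ∈ edgeSpace V, (∀ u v, ¬ G.Adj u v → T u v = 0) ∧ ∀ u, ∑ v, T u v = t u := by
  choose P hP hG hsum using fun v => exists_mem_edgeSpace_of_reachable (hκ v)
  refine ⟨∑ v, t v • P v, sum_mem fun v _ => Submodule.smul_mem _ _ (hP v),
    fun x y hxy => by simp [Finset.sum_apply, hG _ x y hxy], fun x => ?_⟩
  have hself : ∑ v, t v * ind {v} x = t x := by simp [ind]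
  have hroot : ∑ v, t v * ind {κ v} x = 0 := by
    rw [← ht x, sum_filter]
    exact sum_congr rfl fun v _ => by simp [ind, eq_comm]
  simp only [Finset.sum_apply, Pi.smul_apply, smul_eq_mul]
  rw [sum_comm]
  simp only [← mul_sum, hsum, mul_add, sum_add_distrib, hself, hroot, add_zero]

end Join

/-! ### Components of the complement -/

section Components

theorem boole_lt_add_boole_lt_comm {V α β : Type*} [LinearOrder α] [LinearOrder β] {σ : V → α}
    {τ : V → β} (hσ : σ.Injective) (hτ : τ.Injective) (u v : V) :
    (if σ v < σ u then 1 else 0) + (if τ v < τ u then 1 else 0 : ZMod 2) =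
      (if σ u < σ v then 1 else 0) + (if τ u < τ v then 1 else 0) := by
  by_cases huv : u = v
  · rw [huv]
  rcases lt_or_gt_of_ne (hσ.ne huv) with h₁ | h₁ <;> rcases lt_or_gt_of_ne (hτ.ne huv) with h₂ | h₂
  · simp [h₁, h₂, h₁.not_gt, h₂.not_gt, CharTwo.add_self_eq_zero]
  · simp [h₁, h₂, h₁.not_gt, h₂.not_gt]
  · simp [h₁, h₂, h₁.not_gt, h₂.not_gt]
  · simp [h₁, h₂, h₁.not_gt, h₂.not_gt, CharTwo.add_self_eq_zero]

variable {V : Type*} [Fintype V] [LinearOrder V]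

open scoped Classical in
/-- The least vertex in the component of `v` in the complement. -/
noncomputable def root (D : OrientedGraph V) (v : V) : V :=
  ({u | D.complGraph.Reachable v u} : Finset V).min' ⟨v, by simp⟩

theorem reachable_root (D : OrientedGraph V) (v : V) : D.complGraph.Reachable v (D.root v) := by
  classical
  exact (mem_filter.mp (min'_mem _ _)).2

theorem root_le {D : OrientedGraph V} {u v : V} (h : D.complGraph.Reachable v u) :
    D.root v ≤ u :=
  min'_le _ _ (by simpa using h)

theorem root_eq_root_iff {D : OrientedGraph V} {u v : V} :
    D.root u = D.root v ↔ D.complGraph.Reachable u v := by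
  constructor
  · intro h
    exact (D.reachable_root u).trans (h ▸ (D.reachable_root v).symm)
  · intro h
    exact le_antisymm (root_le (h.trans (D.reachable_root v)))
      (root_le (h.symm.trans (D.reachable_root u)))

theorem root_root (D : OrientedGraph V) (v : V) : D.root (D.root v) = D.root v :=
  root_eq_root_iff.mpr (D.reachable_root v).symm

theorem root_eq_self_iff {D : OrientedGraph V} {v : V} :
    D.root v = v ↔ ¬ ∃ u, D.root u = D.root v ∧ u < v := by
  constructor
  · rintro h ⟨u, hu, huv⟩
    exact huv.not_ge (h ▸ root_le (root_eq_root_iff.mp hu.symm))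
  · intro h
    by_contra hne
    exact h ⟨D.root v, D.root_root v, (root_le (SimpleGraph.Reachable.refl _)).lt_of_ne hne⟩

theorem not_complGraph_adj_of_root_ne {D : OrientedGraph V} {u v : V} (h : D.root u ≠ D.root v) :
    ¬ D.complGraph.Adj u v :=
  fun hadj => h (root_eq_root_iff.mpr hadj.reachable)

open scoped Classical in
/-- The part of `mismatch σ u v + [σ v < σ u]` that does not depend on the order `σ`: between
components it is the adjacency in `D`, and inside a component the order of `V` stands in for `σ`. -/
noncomputable def weight (D : OrientedGraph V) (u v : V) : ZMod 2 :=
  if D.root u = D.root v then (if v < u then 1 else 0) else if D.Adj u v then 1 else 0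

/-- The parity that the sum of the positions of the vertices in the component with root `r` has in
every suitable order. -/
noncomputable def parity (D : OrientedGraph V) (r : V) : ZMod 2 :=
  ∑ u with D.root u = r, ∑ v, D.weight u v

theorem sum_fiber_sum_mismatch (D : OrientedGraph V) (σ : V ≃ Fin (Fintype.card V)) (r : V) :
    ∑ u with D.root u = r, ∑ v, D.mismatch σ u v =
      ∑ u with D.root u = r, ((σ u : ℕ) : ZMod 2) + D.parity r := by
  set H : V → V → ZMod 2 := fun u v =>
    D.mismatch σ u v + ((if σ v < σ u then 1 else 0) + D.weight u v) with hH
  have hdiff : ∀ u v, D.root u ≠ D.root v → H u v = 0 := by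
    intro u v h
    simp only [hH, weight, h, if_false]
    rw [← add_assoc, mismatch_add_lt σ.injective (not_complGraph_adj_of_root_ne h),
      CharTwo.add_self_eq_zero]
  have hmem : H ∈ edgeSpace V := by
    refine ⟨fun u v => ?_, fun u => by simp [hH, weight, (D.mismatch_mem_edgeSpace σ).2]⟩
    by_cases h : D.root u = D.root v
    · simp only [hH, weight, h, if_true, (D.mismatch_mem_edgeSpace σ).1 v u]
      exact congrArg _ (boole_lt_add_boole_lt_comm σ.injective Function.injective_id u v)
    · rw [hdiff u v h, hdiff v u (Ne.symm h)]
  have hzero := sum_fiber_sum_eq_zero hmem hdiff r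
  simp only [hH, sum_add_distrib, sum_boole_lt_eq] at hzero
  exact CharTwo.add_eq_zero.mp hzero

theorem exists_mem_cycleSpace_iff (D : OrientedGraph V) (σ : V ≃ Fin (Fintype.card V)) :
    (∃ S ∈ cycleSpace V, ∀ u v, D.FlipAdj S u v → σ v < σ u) ↔
      ∀ r, ∑ u with D.root u = r, ((σ u : ℕ) : ZMod 2) = D.parity r := by
  have hM := D.mismatch_mem_edgeSpace σ
  have hiff : ∀ r, ∑ u with D.root u = r, ((σ u : ℕ) : ZMod 2) = D.parity r ↔
      ∑ u with D.root u = r, ∑ v, D.mismatch σ u v = 0 := by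
    intro r
    rw [sum_fiber_sum_mismatch, CharTwo.add_eq_zero]
  simp only [hiff]
  constructor
  · rintro ⟨S, hS, hσ⟩ r
    have hflip := (forall_flipAdj_lt_iff σ.injective hS.1).mp hσ
    have hdiff : ∀ u v, D.root u ≠ D.root v → (S + D.mismatch σ) u v = 0 := by
      intro u v h
      rw [Pi.add_apply, Pi.add_apply, hflip u v (not_complGraph_adj_of_root_ne h),
        CharTwo.add_self_eq_zero]
    simpa [sum_add_distrib, hS.2] using sum_fiber_sum_eq_zero (add_mem hS.1 hM) hdiff r
  · intro h
    obtain ⟨T, hT, hsupp, hsum⟩ := exists_mem_edgeSpace_sum_eq D.reachable_root h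
    refine ⟨D.mismatch σ + T, ⟨add_mem hM hT, fun u => ?_⟩,
      (forall_flipAdj_lt_iff σ.injective (add_mem hM hT)).mpr fun u v huv => ?_⟩
    · simp only [Pi.add_apply, sum_add_distrib, hsum, CharTwo.add_self_eq_zero]
    · simp [hsupp u v huv]

theorem natCast_half_card_eq_sum_parity (D : OrientedGraph V) :
    ((Fintype.card V / 2 : ℕ) : ZMod 2) = ∑ r, D.parity r := by
  obtain ⟨O, hO, hκ⟩ := (exists_equiv_fin_sum_fiber_eq_iff D.root _).mp
    ⟨Fintype.equivFin V, fun _ => rfl⟩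
  have hzero : ∑ r, ∑ u with D.root u = r, ∑ v, D.mismatch (Fintype.equivFin V) u v = 0 := by
    rw [sum_fiberwise, ← sum_fiber_sum_eq_zero (D.mismatch_mem_edgeSpace (Fintype.equivFin V))
      (κ := fun _ => ()) (by simp) ()]
    simp
  simp only [sum_fiber_sum_mismatch, sum_add_distrib, ← hκ] at hzero
  rw [← hO, ← sum_fiberParity D.root]
  exact CharTwo.add_eq_zero.mp hzero

theorem filter_root_eq_empty {D : OrientedGraph V} {v : V} (h : D.root v ≠ v) :
    ({u | D.root u = v} : Finset V) = ∅ :=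
  filter_eq_empty_iff.mpr fun u _ hu => h (by rw [← hu, root_root])

theorem isEqInvertible_iff_card {p : ℕ} (hp : 3 ≤ p) (hodd : Odd p)
    (hV : p + 2 ≤ Fintype.card V) (D : OrientedGraph V) :
    D.IsEqInvertible p ↔ 2 * #{r | D.parity r = 1} ≤ Fintype.card V + 1 ∧
      2 * #{r | fiberParity D.root univ r + D.parity r = 1} ≤ Fintype.card V + 1 := by
  have hroot : ∀ r, D.parity r = 1 → ∃ u, D.root u = r := by
    intro r hr
    by_contra h
    rw [parity, filter_root_eq_empty fun h' => h ⟨r, h'⟩] at hr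
    exact zero_ne_one hr
  have hsum := D.natCast_half_card_eq_sum_parity
  rw [isEqInvertible_iff_of_odd hp hodd hV]
  simp only [exists_mem_cycleSpace_iff]
  rw [exists_equiv_fin_sum_fiber_eq_iff, exists_card_eq_fiberParity_eq_iff (by lia) hsum hroot]
  have hmod : Fintype.card V / 2 % 2 = #{r | D.parity r = 1} % 2 :=
    (ZMod.natCast_eq_natCast_iff' _ _ 2).mp (hsum.trans (natCast_card_filter_eq_one _).symm)
  lia

end Components

section Small

variable {V : Type*} [Fintype V]

theorem isAcyclic_invert_iff {D : OrientedGraph V} {X : Finset V} (h : #X = 1 ∨ X = univ) :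
    (D.invert X).IsAcyclic ↔ D.IsAcyclic := by
  rcases h with h | rfl
  · obtain ⟨x, rfl⟩ := card_eq_one.mp h
    have hadj : (D.invert {x}).Adj = D.Adj := by
      funext u v
      have := D.not_adj_self x
      simp only [invert, mem_singleton, eq_iff_iff]
      grind
    rw [IsAcyclic, IsAcyclic, hadj]
  · have hadj : (D.invert univ).Adj = Function.swap D.Adj := by
      funext u v
      simp [invert, Function.swap]
    simp only [IsAcyclic, hadj, Relation.transGen_swap]

theorem isEqInvertible_iff_isAcyclic {p : ℕ} (h : p = 1 ∨ Fintype.card V ≤ p)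
    (D : OrientedGraph V) : D.IsEqInvertible p ↔ D.IsAcyclic := by
  have hX : ∀ X : Finset V, #X = p → #X = 1 ∨ X = univ := fun X hX =>
    h.imp hX.trans fun h => (card_eq_iff_eq_univ X).mp ((card_le_univ X).antisymm (hX ▸ h))
  constructor
  · rintro ⟨F, hF, h⟩
    induction F generalizing D with
    | nil => exact h
    | cons X F ih =>
      exact (isAcyclic_invert_iff (hX X (hF X (by simp)))).mp
        (ih _ (fun Y hY => hF Y (by simp [hY])) h)
  · intro h
    exact ⟨[], by simp, h⟩

end Small

section Iteration

variable {V : Type*}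

/-- The heads of arcs with tail in `P`. -/
def outSet (D : OrientedGraph V) (P : V → Prop) (v : V) : Prop :=
  ∃ u, P u ∧ D.Adj u v

theorem lt_of_iterate_outSet {D : OrientedGraph V} {n : ℕ} {σ : V → Fin n}
    (hσ : ∀ u v, D.Adj u v → σ v < σ u) {t : ℕ} {v : V}
    (h : (D.outSet^[t] fun _ => True) v) : (σ v : ℕ) + t < n := by
  induction t generalizing v with
  | zero => exact (σ v).2
  | succ t ih =>
    rw [Function.iterate_succ_apply'] at h
    obtain ⟨u, hu, huv⟩ := h
    have hlt : (σ v : ℕ) < σ u := hσ u v huv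
    have := ih hu
    lia

theorem iterate_outSet_of_transGen {D : OrientedGraph V} (t : ℕ) {v : V}
    (h : Relation.TransGen D.Adj v v) : (D.outSet^[t] fun _ => True) v := by
  induction t generalizing v with
  | zero => trivial
  | succ t ih =>
    obtain ⟨u, hvu, huv⟩ := Relation.TransGen.tail'_iff.mp h
    rw [Function.iterate_succ_apply']
    exact ⟨u, ih (Relation.TransGen.head' huv hvu), huv⟩

theorem isAcyclic_iff_iterate [Fintype V] (D : OrientedGraph V) :
    D.IsAcyclic ↔ ∀ v, ¬ (D.outSet^[Fintype.card V] fun _ => True) v := by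
  constructor
  · intro h v hv
    obtain ⟨σ, hσ⟩ := exists_equiv_fin_of_not_transGen h
    have := lt_of_iterate_outSet hσ hv
    lia
  · exact fun h v hv => h v (iterate_outSet_of_transGen _ hv)

/-- The vertices that have no arc to some vertex of `P`, in either direction. -/
def nonNeighbors (D : OrientedGraph V) (P : V → Prop) (v : V) : Prop :=
  ∃ u, P u ∧ ¬ D.Adj u v ∧ ¬ D.Adj v u

theorem reachable_of_iterate_nonNeighbors {D : OrientedGraph V} {t : ℕ} {u v : V}
    (h : (D.nonNeighbors^[t] fun w => w = u) v) : D.complGraph.Reachable u v := by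
  induction t generalizing v with
  | zero => exact h.symm ▸ SimpleGraph.Reachable.refl u
  | succ t ih =>
    rw [Function.iterate_succ_apply'] at h
    obtain ⟨w, hw, hwv⟩ := h
    by_cases hne : w = v
    · exact hne ▸ ih hw
    · exact (ih hw).trans (SimpleGraph.Adj.reachable ⟨hne, hwv⟩)

theorem iterate_nonNeighbors_of_walk {D : OrientedGraph V} {u v w : V}
    (q : D.complGraph.Walk v w) {t : ℕ} (h : (D.nonNeighbors^[t] fun x => x = u) v) :
    (D.nonNeighbors^[t + q.length] fun x => x = u) w := by
  induction q generalizing t with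
  | nil => exact h
  | @cons v x w hvx q ih =>
    rw [SimpleGraph.Walk.length_cons, Nat.add_comm q.length, ← Nat.add_assoc]
    refine ih ?_
    rw [Function.iterate_succ_apply']
    exact ⟨v, h, hvx.2⟩

theorem iterate_nonNeighbors_mono {D : OrientedGraph V} {s t : ℕ} (hst : s ≤ t) {u v : V}
    (h : (D.nonNeighbors^[s] fun w => w = u) v) : (D.nonNeighbors^[t] fun w => w = u) v := by
  induction t, hst using Nat.le_induction with
  | base => exact h
  | succ t _ ih =>
    rw [Function.iterate_succ_apply']
    exact ⟨v, ih, D.not_adj_self v, D.not_adj_self v⟩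

theorem iterate_nonNeighbors_iff [Fintype V] [LinearOrder V] (D : OrientedGraph V) (u v : V) :
    (D.nonNeighbors^[Fintype.card V] fun w => w = u) v ↔ D.root v = D.root u := by
  rw [eq_comm, root_eq_root_iff]
  refine ⟨reachable_of_iterate_nonNeighbors, fun h => ?_⟩
  obtain ⟨q, hq⟩ := h.exists_isPath
  have hlen : 0 + q.length ≤ Fintype.card V := by
    rw [zero_add]
    exact hq.length_lt.le
  exact iterate_nonNeighbors_mono hlen (iterate_nonNeighbors_of_walk q rfl)

end Iteration

end OrientedGraph

/-! ### Stack programs -/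

namespace StackProg

open Turing Function StateTransition

/-- Structured programs acting on stacks indexed by `K` with symbols in `A`. They are translated
into machines once and for all, so that machines need not be written down by hand. -/
inductive Cmd (K A : Type) : Type
  | skip : Cmd K A
  | push (k : K) (a : A) : Cmd K A
  /-- Pop the stack `k` and branch on the symbol found. -/
  | pop (k : K) (f : Option A → Cmd K A) : Cmd K A
  | seq (c d : Cmd K A) : Cmd K A
  /-- Pop the stack `k` repeatedly and run `f a` on the symbols `a` found, until the stack is empty
  or `g a` fails. -/
  | loop (k : K) (g : A → Bool) (f : A → Cmd K A) : Cmd K A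

namespace Cmd

variable {K A : Type}

/-- The program labels used by the translation of a command into a machine. -/
def Label : Cmd K A → Type
  | skip => Unit
  | push _ _ => Unit
  | pop _ f => Option (Σ o, (f o).Label)
  | seq c d => c.Label ⊕ d.Label
  | loop _ _ f => Option (Σ a, (f a).Label)

theorem finite_label [Finite A] (c : Cmd K A) : Finite c.Label := by
  induction c with
  | skip => exact inferInstanceAs (Finite Unit)
  | push => exact inferInstanceAs (Finite Unit)
  | pop k f ih => exact inferInstanceAs (Finite (Option (Σ o, (f o).Label)))
  | seq c d ihc ihd => exact inferInstanceAs (Finite (c.Label ⊕ d.Label))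
  | loop k g f ih => exact inferInstanceAs (Finite (Option (Σ a, (f a).Label)))

/-- The label at which the execution of a command starts. -/
def entry : (c : Cmd K A) → c.Label
  | skip => ()
  | push _ _ => ()
  | pop _ _ => none
  | seq c _ => Sum.inl c.entry
  | loop _ _ _ => none

end Cmd

/-- The stack alphabets of the machine: there is one additional stack for the output. -/
def Alphabet (K A : Type) : Option K → Type
  | none => Bool
  | some _ => A

variable {K A Λ : Type}

/-- The machine statement at a label of a command, where `ι` embeds the labels of the command into
those of the machine and `exit` is the label to continue with. -/
def Cmd.code : (c : Cmd K A) → (c.Label → Λ) → Λ → c.Label →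
    TM2.Stmt (Alphabet K A) Λ (Option A)
  | skip, _, exit, _ => .goto fun _ => exit
  | push k a, _, exit, _ => .push (some k) (fun _ => a) (.goto fun _ => exit)
  | pop k f, ι, _, none =>
      .pop (some k) (fun _ o => o) (.goto fun o => ι (some ⟨o, (f o).entry⟩))
  | pop _ f, ι, exit, some ⟨o, l⟩ => (f o).code (fun l => ι (some ⟨o, l⟩)) exit l
  | seq c d, ι, _, .inl l => c.code (fun l => ι (.inl l)) (ι (.inr d.entry)) l
  | seq _ d, ι, exit, .inr l => d.code (fun l => ι (.inr l)) exit l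
  | loop k g f, ι, exit, none =>
      .pop (some k) (fun _ o => o) (.goto fun o =>
        (o.filter g).elim exit fun a => ι (some ⟨a, (f a).entry⟩))
  | loop _ _ f, ι, _, some ⟨a, l⟩ => (f a).code (fun l => ι (some ⟨a, l⟩)) (ι none) l

/-- The stacks of the machine, with an empty output stack. -/
def extend (s : K → List A) : ∀ k, List (Alphabet K A k)
  | none => []
  | some k => s k

variable [DecidableEq K]

/-- `Runs c s s' T`: the command `c` turns the stacks `s` into `s'` in at most `T` steps. -/
inductive Runs : Cmd K A → (K → List A) → (K → List A) → ℕ → Prop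
  | skip (s) : Runs .skip s s 1
  | push (s k a) : Runs (.push k a) s (update s k (a :: s k)) 1
  | pop {k f s s' T} (h : Runs (f (s k).head?) (update s k (s k).tail) s' T) :
      Runs (.pop k f) s s' (T + 1)
  | seq {c d s s₁ s₂ T₁ T₂} (h₁ : Runs c s s₁ T₁) (h₂ : Runs d s₁ s₂ T₂) :
      Runs (.seq c d) s s₂ (T₁ + T₂)
  | loop_exit {k g f s} (h : ∀ a, (s k).head? = some a → g a = false) :
      Runs (.loop k g f) s (update s k (s k).tail) 1
  | loop_step {k g f s a l s₁ s₂ T₁ T₂} (h : s k = a :: l) (hg : g a = true)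
      (h₁ : Runs (f a) (update s k l) s₁ T₁) (h₂ : Runs (.loop k g f) s₁ s₂ T₂) :
      Runs (.loop k g f) s s₂ (T₁ + T₂ + 1)
  | mono {c s s' T T'} (h : Runs c s s' T) (hT : T ≤ T') : Runs c s s' T'

section Machine

theorem update_extend (s : K → List A) (k : K) (l : List A) :
    (update (extend s) (some k) l : ∀ k, List (Alphabet K A k)) = extend (update s k l) := by
  funext k'
  rcases k' with _ | k'
  · exact update_of_ne (by simp) _ _
  · obtain rfl | h := eq_or_ne k' k
    · exact (update_self (β := fun k => List (Alphabet K A k)) _ _ _).trans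
        (update_self k' l s).symm
    · exact (update_of_ne (β := fun k => List (Alphabet K A k)) (by simpa using h) _ _).trans
        (update_of_ne h _ _).symm

theorem evalsToInTime_single {m : Λ → TM2.Stmt (Alphabet K A) Λ (Option A)} {l : Λ} {q v S y}
    (hq : m l = q) (h : TM2.stepAux q v S = y) :
    Nonempty (EvalsToInTime (TM2.step m) ⟨some l, v, S⟩ (some y) 1) := by
  subst hq
  exact ⟨⟨1, congrArg some h⟩, le_rfl⟩

theorem evalsToInTime_trans {σ : Type*} {f : σ → Option σ} {x y : σ} {z : Option σ} {T T' : ℕ}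
    (h : Nonempty (EvalsToInTime f x (some y) T)) (h' : Nonempty (EvalsToInTime f y z T')) :
    Nonempty (EvalsToInTime f x z (T' + T)) :=
  h.elim fun h => h'.map (EvalsToInTime.trans f T T' x y z h)

theorem Runs.evalsToInTime {c : Cmd K A} {s s' : K → List A} {T : ℕ} (h : Runs c s s' T)
    (m : Λ → TM2.Stmt (Alphabet K A) Λ (Option A)) (ι : c.Label → Λ) (exit : Λ)
    (hm : ∀ l, m (ι l) = c.code ι exit l) (v : Option A) :
    ∃ v', Nonempty (EvalsToInTime (TM2.step m) ⟨some (ι c.entry), v, extend s⟩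
      (some ⟨some exit, v', extend s'⟩) T) := by
  induction h generalizing exit v with
  | skip s => exact ⟨v, evalsToInTime_single (hm _) rfl⟩
  | push s k a => exact ⟨v, evalsToInTime_single (hm _) (by rw [← update_extend]; rfl)⟩
  | @pop k f s _ _ _ ih =>
    obtain ⟨v', hv⟩ := ih (fun l => ι (some ⟨_, l⟩)) exit (fun l => hm _) (s k).head?
    exact ⟨v', evalsToInTime_trans
      (evalsToInTime_single (hm _) (by rw [← update_extend]; rfl)) hv⟩
  | @seq c d _ _ _ _ _ _ _ ih₁ ih₂ =>
    obtain ⟨v₁, hv₁⟩ := ih₁ (fun l => ι (.inl l)) (ι (.inr d.entry)) (fun l => hm _) v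
    obtain ⟨v₂, hv₂⟩ := ih₂ (fun l => ι (.inr l)) exit (fun l => hm _) v₁
    exact ⟨v₂, Nat.add_comm _ _ ▸ evalsToInTime_trans hv₁ hv₂⟩
  | @loop_exit k g f s h =>
    have hexit : (s k).head?.filter g = none :=
      Option.filter_eq_none_iff.mpr fun a ha => by simp [h a ha]
    refine ⟨(s k).head?, evalsToInTime_single (hm _) ?_⟩
    rw [← update_extend]
    exact congrArg (fun o : Option A => (⟨some (o.elim exit fun a => ι (some ⟨a, (f a).entry⟩)),
      _, _⟩ : TM2.Cfg (Alphabet K A) Λ (Option A))) hexit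
  | @loop_step k g f s a l _ _ _ _ h hg _ _ ih₁ ih₂ =>
    obtain ⟨v₁, hv₁⟩ := ih₁ (fun l => ι (some ⟨a, l⟩)) (ι none) (fun l => hm _) (s k).head?
    obtain ⟨v₂, hv₂⟩ := ih₂ ι exit hm v₁
    have hbody : (s k).head?.filter g = some a := by
      rw [h, List.head?_cons, Option.filter_some, if_pos hg]
    refine ⟨v₂, (?_ : _ + _ = _ + _ + 1) ▸ evalsToInTime_trans
      (evalsToInTime_single (hm _) ?_) (evalsToInTime_trans hv₁ hv₂)⟩
    · omega
    · rw [show l = (s k).tail by rw [h]; rfl, ← update_extend]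
      exact congrArg (fun o : Option A => (⟨some (o.elim exit fun a => ι (some ⟨a, (f a).entry⟩)),
        _, _⟩ : TM2.Cfg (Alphabet K A) Λ (Option A))) hbody
  | mono _ hT ih =>
    obtain ⟨v', ⟨hv⟩⟩ := ih ι exit hm v
    exact ⟨v', ⟨hv.toEvalsTo, hv.steps_le_m.trans hT⟩⟩

variable [Fintype K] [Fintype A]

/-- The machine running a command with input stack `i`, and then outputting the Boolean read off
the top of the stack `r`. -/
noncomputable def machine (c : Cmd K A) (i r : K) (out : A → Bool) : FinTM2 :=
  haveI : Fintype c.Label := @Fintype.ofFinite _ c.finite_label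
  { K := Option K
    k₀ := some i
    k₁ := none
    Γ := Alphabet K A
    Λ := Option c.Label
    main := some c.entry
    σ := Option A
    initialState := none
    Γk₀Fin := inferInstanceAs (Fintype A)
    m := fun l => match l with
      | some l => c.code some none l
      | none => .pop (some r) (fun _ o => o)
          (.push none (fun o => (o.map out).getD false) (.load (fun _ => none) .halt)) }

variable (c : Cmd K A) (i r : K) (out : A → Bool)

theorem initList_machine (l : List A) : initList (machine c i r out) l =
    ⟨some (some c.entry), none, extend (update (fun _ => []) i l)⟩ := by
  unfold initList
  congr 1
  funext k
  by_cases hk : k = some i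
  · subst hk
    exact (dif_pos rfl).trans (update_self i l fun _ => []).symm
  · refine (dif_neg hk).trans ?_
    rcases k with _ | k
    · rfl
    · exact (update_of_ne (fun h => hk (congrArg some h)) l fun _ => []).symm

theorem haltList_machine (b : Bool) : haltList (machine c i r out) [b] =
    ⟨none, none, update (extend fun _ => []) none [b]⟩ := by
  unfold haltList
  congr 1
  funext k
  rcases k with _ | k <;> rfl

theorem machine_output (x : A) (v : Option A) :
    Nonempty (EvalsToInTime (machine c i r out).step
      ⟨some none, v, extend (update (fun _ => []) r [x])⟩
      (some (haltList (machine c i r out) [out x])) 1) := by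
  refine evalsToInTime_single rfl ?_
  have hstk : (update (extend (update (fun _ => []) r [x])) (some r)
      (update (fun _ => []) r [x] r).tail : ∀ k, List (Alphabet K A k)) = extend fun _ => [] := by
    rw [update_extend, update_idem, update_self]
    exact congrArg extend (update_eq_self r fun _ => [])
  have hout : ((update (fun _ => []) r [x] r).head?.map out).getD false = out x := by
    rw [update_self]; rfl
  rw [haltList_machine, ← hstk, ← hout]
  rfl

theorem exists_tm2ComputableInPolyTime {K A : Type} [DecidableEq K] [Finite K] [Finite A]
    (c : Cmd K A) (i r : K) (out : A → Bool) {α : Type} (ea : α → List A) (f : α → Bool)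
    (q : Polynomial ℕ)
    (h : ∀ a, ∃ x, out x = f a ∧
      Runs c (update (fun _ => []) i (ea a)) (update (fun _ => []) r [x])
        (q.eval (ea a).length)) :
    ∃ M : TM2ComputableInPolyTime ea Computability.encodeBool f, ∀ k, Finite (M.tm.Γ k) := by
  cases nonempty_fintype K
  cases nonempty_fintype A
  choose x hx hr using h
  have hM : ∀ a, Nonempty (TM2OutputsInTime (machine c i r out) (ea a) (some [f a])
      ((1 + q).eval (ea a).length)) := by
    intro a
    obtain ⟨v, hv⟩ := (hr a).evalsToInTime (machine c i r out).m some none (fun l => rfl) none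
    rw [Polynomial.eval_add, Polynomial.eval_one, ← hx a]
    unfold TM2OutputsInTime
    rw [initList_machine]
    exact evalsToInTime_trans hv (machine_output c i r out (x a) v)
  refine ⟨⟨⟨machine c i r out, Equiv.refl A, Equiv.refl Bool⟩, 1 + q, fun a => ?_⟩, ?_⟩
  · exact (List.map_id (ea a)).symm ▸ (hM a).some
  · rintro (_ | k)
    · exact inferInstanceAs (Finite Bool)
    · exact inferInstanceAs (Finite A)

end Machine

end StackProg

namespace StackProg

open Turing Function

section Macros

variable {K A : Type} [DecidableEq K] {k k' t : K}

namespace Runs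

theorem cast {c : Cmd K A} {s s₁ s₂ : K → List A} {T T' : ℕ} (h : Runs c s s₁ T)
    (hs : s₁ = s₂) (hT : T ≤ T') : Runs c s s₂ T' := hs ▸ h.mono hT

theorem pop_of_eq {f : Option A → Cmd K A} {s s' : K → List A} {o : Option A} {l : List A} {T : ℕ}
    (ho : (s k).head? = o) (hl : (s k).tail = l) (h : Runs (f o) (update s k l) s' T) :
    Runs (.pop k f) s s' (T + 1) := by
  subst ho hl
  exact h.pop

theorem loop_nil {g : A → Bool} {f : A → Cmd K A} {s : K → List A} (h : s k = []) :
    Runs (.loop k g f) s s 1 := by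
  refine (loop_exit (by simp [h])).cast ?_ le_rfl
  rw [h, List.tail_nil, ← h, update_eq_self]

theorem loop_cons_of_false {g : A → Bool} {f : A → Cmd K A} {s : K → List A} {a : A} {l : List A}
    (h : s k = a :: l) (hg : g a = false) : Runs (.loop k g f) s (update s k l) 1 :=
  (loop_exit (by simp [h, hg])).cast (by rw [h, List.tail_cons]) le_rfl

end Runs

/-- Run `f a` on the symbols `a` popped from the stack `k` until it is empty. -/
def Cmd.drain (k : K) (f : A → Cmd K A) : Cmd K A := .loop k (fun _ => true) f

/-- Verification rule for `Cmd.drain`: here `σ d` describes the stacks other than `k` once the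
symbols `d` have been popped, the last one first. -/
theorem Runs.drain {f : A → Cmd K A} {s : K → List A} {T : ℕ} (σ : List A → K → List A)
    (hσ : σ [] = s)
    (hf : ∀ d a r, d.reverse ++ a :: r = s k →
      Runs (f a) (update (σ d) k r) (update (σ (a :: d)) k r) T) :
    Runs (.drain k f) s (update (σ (s k).reverse) k []) ((s k).length * (T + 1) + 1) := by
  have main : ∀ r d, d.reverse ++ r = s k → Runs (.drain k f) (update (σ d) k r)
      (update (σ (s k).reverse) k []) (r.length * (T + 1) + 1) := by
    intro r
    induction r with
    | nil =>
      intro d hd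
      rw [← hd, List.append_nil, List.reverse_reverse]
      exact (loop_nil (update_self ..)).mono (by simp)
    | cons a r ih =>
      intro d hd
      have hbody := hf d a r hd
      have hrest := ih (a :: d) (by simpa using hd)
      rw [← update_idem] at hbody
      refine (loop_step (update_self ..) rfl hbody hrest).mono ?_
      rw [List.length_cons, Nat.add_mul]
      omega
  have h := main (s k) [] rfl
  rwa [hσ, update_eq_self] at h

/-- Verification rule for counting loops: here `σ j` describes the stacks other than `k` after `j`
iterations. -/
theorem Runs.drain_replicate {c : Cmd K A} {a : A} {n T : ℕ} (σ : ℕ → K → List A)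
    (hc : ∀ j r, j + r + 1 = n → Runs c (update (σ j) k (List.replicate r a))
      (update (σ (j + 1)) k (List.replicate r a)) T) :
    Runs (.drain k fun _ => c) (update (σ 0) k (List.replicate n a)) (update (σ n) k [])
      (n * (T + 1) + 1) := by
  have main : ∀ r j, j + r = n → Runs (.drain k fun _ => c)
      (update (σ j) k (List.replicate r a)) (update (σ n) k []) (r * (T + 1) + 1) := by
    intro r
    induction r with
    | zero =>
      rintro j rfl
      exact (loop_nil (update_self ..)).mono (by simp)
    | succ r ih =>
      intro j hj
      have hbody := hc j r hj
      rw [← update_idem (β := fun _ => List A) (List.replicate (r + 1) a)] at hbody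
      refine (loop_step (update_self ..) rfl hbody (ih (j + 1) (by omega))).mono ?_
      rw [Nat.add_mul]
      omega
  exact main n 0 (Nat.zero_add n)

/-- Empty the stack `k`. -/
def clear (k : K) : Cmd K A := .drain k fun _ => .skip

theorem runs_clear (k : K) (s : K → List A) :
    Runs (clear k) s (update s k []) (2 * (s k).length + 1) :=
  (Runs.drain (fun _ => s) rfl fun _ _ _ _ => .skip _).mono (by omega)

/-- Move the content of the stack `k` to the stack `k'`, in reverse order. -/
def move (k k' : K) : Cmd K A := .drain k (.push k')

theorem runs_move (hk : k ≠ k') (s : K → List A) :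
    Runs (move k k') s (update (update s k []) k' ((s k).reverse ++ s k'))
      (2 * (s k).length + 1) := by
  refine (Runs.drain (T := 1) (fun d => update s k' (d ++ s k')) (by simp) ?_).cast
    (update_comm hk.symm _ _ _) (by omega)
  refine fun d a r _ => (Runs.push _ _ _).cast ?_ le_rfl
  grind

/-- Append a reversed copy of the stack `k` to the stack `k'`, using the stack `t`. -/
def copy (k k' t : K) : Cmd K A :=
  .seq (.drain k fun a => .seq (.push t a) (.push k' a)) (move t k)

theorem runs_copy (hkk' : k ≠ k') (hkt : k ≠ t) (hk't : k' ≠ t) (s : K → List A) (ht : s t = []) :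
    Runs (copy k k' t) s (update s k' ((s k).reverse ++ s k')) (5 * (s k).length + 2) := by
  have hdrain := Runs.drain (k := k) (f := fun a => .seq (.push t a) (.push k' a)) (s := s) (T := 2)
    (fun d => update (update s t d) k' (d ++ s k')) (by simp [← ht])
    (fun d a r _ => ((Runs.push _ _ _).seq (.push _ _ _)).cast (by grind) le_rfl)
  exact (hdrain.seq (runs_move hkt.symm _)).cast (by grind)
    (by grind)

/-- Move the top symbol of the stack `m`, if there is one, to the stack `m'`. -/
def transfer (m m' : K) : Cmd K A := .pop m fun o => o.elim .skip (.push m')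

theorem runs_transfer {m m' : K} (hm : m ≠ m') (s : K → List A) :
    Runs (transfer m m') s (update (update s m (s m).tail) m' ((s m).head?.toList ++ s m')) 2 := by
  refine .pop (T := 1) ?_
  rcases (s m).head? with _ | a
  · exact (Runs.skip _).cast (by grind) le_rfl
  · exact (Runs.push _ _ _).cast (by grind) le_rfl

/-- Move as many symbols from the stack `m` to the stack `m'` as there are symbols on the stack `i`,
moving the latter to the stack `t`. -/
def shift (i t m m' : K) : Cmd K A := .drain i fun a => .seq (.push t a) (transfer m m')

theorem runs_shift {i t m m' : K} (hit : i ≠ t) (him : i ≠ m) (him' : i ≠ m') (htm : t ≠ m)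
    (htm' : t ≠ m') (hmm' : m ≠ m') (s : K → List A) :
    Runs (shift i t m m') s
      (update (update (update (update s i []) t ((s i).reverse ++ s t)) m
        ((s m).drop (s i).length)) m' (((s m).take (s i).length).reverse ++ s m'))
      (4 * (s i).length + 1) := by
  refine (Runs.drain (T := 3) (fun d => update (update (update s t (d ++ s t)) m
    ((s m).drop d.length)) m' (((s m).take d.length).reverse ++ s m')) (by simp) ?_).cast
    (by grind) (by omega)
  intro d a r _
  have hdrop : (s m).drop (d.length + 1) = ((s m).drop d.length).tail := by simp
  have htake : (s m).take (d.length + 1) =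
      (s m).take d.length ++ ((s m).drop d.length).head?.toList := by
    rw [List.take_add_one, List.head?_drop]
  have hrev (o : Option A) : o.toList.reverse = o.toList := by cases o <;> rfl
  refine ((Runs.push _ _ _).seq (runs_transfer hmm' _)).cast ?_ le_rfl
  grind

/-- Look at the top symbol of the stack `k`, leaving it in place. -/
def peek (k : K) (f : Option A → Cmd K A) : Cmd K A :=
  .pop k fun o => .seq (o.elim .skip (.push k)) (f o)

theorem runs_peek {f : Option A → Cmd K A} {s s' : K → List A} {T : ℕ}
    (h : Runs (f (s k).head?) s s' T) : Runs (peek k f) s s' (T + 2) := by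
  have hback : Runs ((s k).head?.elim .skip (.push k)) (update s k (s k).tail) s 1 := by
    rcases hk : s k with _ | ⟨a, l⟩
    · exact (Runs.skip _).cast (by grind) le_rfl
    · exact (Runs.push _ _ _).cast (by grind) le_rfl
  exact (hback.seq h).pop.mono (by omega)

end Macros

open Computability

/-- The stacks: the input, the order, the adjacency matrix, results, scratch stacks, and four
stacks for each of the bound variables named by `B`. -/
inductive Stk (B : Type) : Type
  | inp | size | mat | res | tmp₁ | tmp₂ | tmp₃
  | idx (b : B) | rem (b : B) | vec (b : B) | buf (b : B)
  deriving DecidableEq, Fintype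

/-- The symbol used to represent numbers in unary. -/
abbrev one : Γ' := Γ'.bit true

/-- Whether the symbol is the bit `true`. -/
def isOne (o : Option Γ') : Bool := o = some one

@[simp] theorem isOne_bit (b : Bool) : isOne (some (Γ'.bit b)) = b := by
  cases b <;> simp [isOne, one]

variable {B : Type} [DecidableEq B]

open Stk

/-- Push on `res` a bit depending on the symbol of the stack `m` whose position is the length of the
stack `i`, and return the symbols on `tmp₃` to `m`. -/
def lookup (i m : Stk B) (f : Option Γ' → Bool) : Cmd (Stk B) Γ' :=
  .seq (shift i tmp₁ m tmp₃) (.seq (move tmp₁ i) (peek m fun o =>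
    .seq (move tmp₃ m) (.push res (.bit (f o)))))

theorem runs_lookup {i m : Stk B} (hi₁ : i ≠ tmp₁) (him : i ≠ m) (hi₃ : i ≠ tmp₃) (hir : i ≠ res)
    (hm₁ : m ≠ tmp₁) (hm₃ : m ≠ tmp₃) (hmr : m ≠ res) (f : Option Γ' → Bool)
    (s : Stk B → List Γ') (ht : s tmp₁ = []) :
    Runs (lookup i m f) s
      (update (update (update s m ((s tmp₃).reverse ++ s m)) tmp₃ []) res
        (.bit (f (s m)[(s i).length]?) :: s res))
      (8 * (s i).length + 2 * (s tmp₃).length + 6) := by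
  refine ((runs_shift hi₁ him hi₃ hm₁.symm (by simp) hm₃ s).seq
    ((runs_move hi₁.symm _).seq
      (runs_peek ((runs_move hm₃.symm _).seq (Runs.push _ _ _))))).cast ?_ ?_
  · have := List.take_append_drop (s i).length (s m)
    rw [← List.head?_drop]
    funext x
    simp only [update_apply]
    split_ifs <;> simp_all
  · grind

end StackProg

/-! ### Queries -/

namespace StackProg

open Turing Function Computability Stk

variable {B : Type}

/-- The stacks `s` represent the graph with adjacency matrix `M` of order `n`, and the values `ρ`
and `V` of the variables, where only names in `L` are in use. -/
structure Represents (n : ℕ) (M : List Bool) (L : List B) (ρ : B → ℕ) (V : B → List Bool)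
    (s : Stk B → List Γ') : Prop where
  size : s size = List.replicate n one
  mat : s mat = M.map Γ'.bit
  tmp₁ : s tmp₁ = []
  tmp₂ : s tmp₂ = []
  tmp₃ : s tmp₃ = []
  idx : ∀ b, s (idx b) = List.replicate (ρ b) one
  vec : ∀ b, s (vec b) = (V b).map Γ'.bit
  le : ∀ b, ρ b ≤ n
  fresh : ∀ b ∉ L, s (.idx b) = [] ∧ s (rem b) = [] ∧ s (.vec b) = [] ∧ s (buf b) = []

theorem Represents.mono {n : ℕ} {M : List Bool} {L L' : List B} {ρ : B → ℕ} {V : B → List Bool}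
    {s : Stk B → List Γ'} (h : Represents n M L ρ V s) (hL : L ⊆ L') : Represents n M L' ρ V s :=
  { h with fresh := fun b hb => h.fresh b fun hb' => hb (hL hb') }

variable [DecidableEq B]

/-- Run `body` once for each index below the order, the index being kept in unary on `idx i`. -/
def forEach (i : B) (body : Cmd (Stk B) Γ') : Cmd (Stk B) Γ' :=
  .seq (copy size (rem i) tmp₁)
    (.seq (.drain (rem i) fun _ => .seq body (.push (idx i) one)) (clear (idx i)))

/-- The stacks `s` with the index `j` on `idx i` and `r` further iterations to go. -/
def withIndex (s : Stk B → List Γ') (i : B) (j r : ℕ) : Stk B → List Γ' :=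
  update (update s (idx i) (List.replicate j one)) (rem i) (List.replicate r one)

theorem runs_forEach {i : B} {body : Cmd (Stk B) Γ'} {n T : ℕ} (σ : ℕ → Stk B → List Γ')
    (hsize : σ 0 size = List.replicate n one) (htmp : σ 0 tmp₁ = [])
    (hidx : ∀ j, σ j (idx i) = []) (hrem : ∀ j, σ j (rem i) = [])
    (hbody : ∀ j r, j + r + 1 = n →
      Runs body (withIndex (σ j) i j r) (withIndex (σ (j + 1)) i j r) T) :
    Runs (forEach i body) (σ 0) (σ n) (n * (T + 9) + 4) := by
  have hcopy : Runs (copy size (rem i) tmp₁) (σ 0) (withIndex (σ 0) i 0 n) (5 * n + 2) := by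
    refine (runs_copy (by simp) (by simp) (by simp) _ htmp).cast ?_ (by simp [hsize])
    have := hidx 0
    have := hrem 0
    simp only [withIndex]
    grind
  have hloop : Runs (.drain (rem i) fun _ => .seq body (.push (idx i) one))
      (withIndex (σ 0) i 0 n) (withIndex (σ n) i n 0) (n * (T + 2) + 1) := by
    refine Runs.drain_replicate (fun j => update (σ j) (idx i) (List.replicate j one)) ?_
    refine fun j r hj => ((hbody j r hj).seq (Runs.push _ _ _)).cast ?_ le_rfl
    simp only [withIndex]
    grind
  refine (hcopy.seq (hloop.seq (runs_clear (idx i) _))).cast ?_ ?_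
  · have := hidx n
    have := hrem n
    simp only [withIndex]
    grind
  · simp only [withIndex, ne_eq, reduceCtorEq, not_false_eq_true, update_of_ne, update_self,
      List.length_replicate, Nat.mul_add]
    omega

/-- Advance `mat` by as many rows as there are symbols on the stack `i`. -/
def skipRows (i : Stk B) : Cmd (Stk B) Γ' :=
  .seq (.drain i fun a => .seq (.push tmp₂ a) (.seq (shift size tmp₁ mat tmp₃) (move tmp₁ size)))
    (move tmp₂ i)

theorem runs_skipRows (i : B) (s : Stk B → List Γ') (h₁ : s tmp₁ = []) (h₂ : s tmp₂ = []) :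
    Runs (skipRows (idx i)) s
      (update (update s mat ((s mat).drop ((s (idx i)).length * (s size).length))) tmp₃
        (((s mat).take ((s (idx i)).length * (s size).length)).reverse ++ s tmp₃))
      ((s (idx i)).length * (6 * (s size).length + 6) + 2) := by
  have hloop := Runs.drain (k := idx i) (s := s) (T := 6 * (s size).length + 3)
    (f := fun a => .seq (.push tmp₂ a) (.seq (shift size tmp₁ mat tmp₃) (move tmp₁ size)))
    (fun d => update (update (update s mat ((s mat).drop (d.length * (s size).length))) tmp₃
      (((s mat).take (d.length * (s size).length)).reverse ++ s tmp₃)) tmp₂ d) (by simp [h₂]) ?_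
  · refine (hloop.seq (runs_move (by simp) _)).cast ?_ ?_
    · funext x
      simp only [update_apply]
      split_ifs <;> simp_all
    · simp only [ne_eq, reduceCtorEq, not_false_eq_true, update_of_ne, update_self,
        List.length_reverse, Nat.mul_add]
      omega
  · intro d a r _
    refine ((Runs.push _ _ _).seq ((runs_shift (by simp) (by simp) (by simp) (by simp)
      (by simp) (by simp) _).seq (runs_move (by simp) _))).cast ?_ ?_
    · funext x
      simp only [update_apply]
      split_ifs <;> simp_all [Nat.add_mul, List.take_add, List.drop_drop]
    · simp [h₁]
      omega

/-- Empty the stack `k`, and push on `res` whether it has at most one symbol more than the stack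
`size`. -/
def testLeSucc (k : Stk B) : Cmd (Stk B) Γ' :=
  .seq (shift size tmp₁ k tmp₃) (.seq (move tmp₁ size) (.seq (clear tmp₃)
    (.pop k fun _ => .pop k fun o => .seq (clear k) (.push res (.bit o.isNone)))))

theorem runs_testLeSucc (i : B) (s : Stk B → List Γ') (h₁ : s tmp₁ = []) (h₃ : s tmp₃ = []) :
    Runs (testLeSucc (buf i)) s
      (update (update s (buf i) []) res
        (.bit (decide ((s (buf i)).length ≤ (s size).length + 1)) :: s res))
      (6 * (s size).length + 2 * (s (buf i)).length + 8) := by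
  refine ((runs_shift (by simp) (by simp) (by simp) (by simp) (by simp) (by simp) _).seq
    ((runs_move (by simp) _).seq ((runs_clear _ _).seq
      (((runs_clear _ _).seq (Runs.push _ _ _)).pop.pop)))).cast ?_ ?_
  · have htest : ((s (buf i)).drop (s size).length).tail.head?.isNone =
        decide ((s (buf i)).length ≤ (s size).length + 1) := by
      rw [Bool.eq_iff_iff]
      simp
    rw [← htest]
    funext x
    simp only [update_apply]
    split_ifs <;> simp_all
  · simp [h₁, h₃]
    omega

/-- Pop two bits from `res`, and push the value of the operation `op` on them. -/
def combine (op : Bool → Bool → Bool) : Cmd (Stk B) Γ' :=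
  .pop res fun o' => .pop res fun o => .push res (.bit (op (isOne o) (isOne o')))

theorem runs_combine (op : Bool → Bool → Bool) {b b' : Bool} {l : List Γ'}
    {s : Stk B → List Γ'} (h : s res = .bit b' :: .bit b :: l) :
    Runs (combine op) s (update s res (.bit (op b b') :: l)) 3 := by
  refine (Runs.push _ _ _).pop.pop.cast ?_ le_rfl
  simp [h]

/-- Boolean queries about a directed graph on `0, …, n - 1`. The index variables and the variables
for sets of vertices are named by `B`. -/
inductive Query (B : Type) : Type
  | arc (i j : B)
  | lt (i j : B)
  | mem (x i : B)
  | bin (op : Bool → Bool → Bool) (e e' : Query B)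
  /-- Fold the operation `op` over the values of `e` for all indices `i`. -/
  | fold (op : Bool → Bool → Bool) (i : B) (e : Query B)
  /-- At most half of `n + 1` indices `i` satisfy `e`. -/
  | few (i : B) (e : Query B)
  /-- Evaluate `e` for the set `x` obtained from the set of all `i` satisfying `e₀` by replacing it
  `n` times by the set of all `i` satisfying `e₁`. -/
  | iter (x i : B) (e₀ e₁ e : Query B)

/-- Replace the set `x` by the set of all `i` satisfying the query evaluated by `c`. -/
def tabulate (x i : B) (c : Cmd (Stk B) Γ') : Cmd (Stk B) Γ' :=
  .seq (forEach i (.seq c (transfer res (buf x)))) (.seq (clear (vec x)) (move (buf x) (vec x)))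

open Polynomial in
/-- A bound for the running time of `tabulate`. -/
noncomputable def tabulateCost (p : ℕ[X]) : ℕ[X] := X * (p + C 15) + C 6

namespace Query

/-- The value of a query, where `M` lists the entries of the adjacency matrix. -/
def eval (n : ℕ) (M : List Bool) : Query B → (B → ℕ) → (B → List Bool) → Bool
  | arc i j, ρ, _ => M[ρ i * n + ρ j]?.getD false
  | lt i j, ρ, _ => decide (ρ i < ρ j)
  | mem x i, ρ, V => (V x)[ρ i]?.getD false
  | bin op e e', ρ, V => op (e.eval n M ρ V) (e'.eval n M ρ V)
  | fold op i e, ρ, V =>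
      (List.range n).foldl (fun b j => op b (e.eval n M (update ρ i j) V)) false
  | few i e, ρ, V => decide
      (2 * (List.range n).countP (fun j => e.eval n M (update ρ i j) V) ≤ n + 1)
  | iter x i e₀ e₁ e, ρ, V => e.eval n M ρ (update V x
      ((fun W => (List.range n).map fun j => e₁.eval n M (update ρ i j) (update V x W))^[n]
        ((List.range n).map fun j => e₀.eval n M (update ρ i j) V)))

/-- No name is bound within its own scope, names in `L` being in use. -/
def Scoped : Query B → List B → Prop
  | arc _ _, _ => True
  | lt i j, _ => i ≠ j
  | mem _ _, _ => True
  | bin _ e e', L => e.Scoped L ∧ e'.Scoped L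
  | fold _ i e, L => i ∉ L ∧ e.Scoped (i :: L)
  | few i e, L => i ∉ L ∧ e.Scoped (i :: L)
  | iter x i e₀ e₁ e, L => x ∉ L ∧ i ∉ L ∧ i ≠ x ∧ e₀.Scoped (i :: x :: L) ∧
      e₁.Scoped (i :: x :: L) ∧ e.Scoped (x :: L)

/-- The command pushing the value of a query on the stack `res`. -/
def compile : Query B → Cmd (Stk B) Γ'
  | arc i j => .seq (skipRows (idx i)) (lookup (idx j) mat isOne)
  | lt i j => lookup (idx i) (idx j) Option.isSome
  | mem x i => lookup (idx i) (vec x) isOne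
  | bin op e e' => .seq e.compile (.seq e'.compile (combine op))
  | fold op i e => .seq (.push res (.bit false)) (forEach i (.seq e.compile (combine op)))
  | few i e => .seq (forEach i (.seq e.compile (.pop res fun o =>
      if isOne o then .seq (.push (buf i) one) (.push (buf i) one) else .skip)))
        (testLeSucc (buf i))
  | iter x i e₀ e₁ e => .seq (tabulate x i e₀.compile) (.seq (copy size (rem x) tmp₁)
      (.seq (.drain (rem x) fun _ => tabulate x i e₁.compile) (.seq e.compile (clear (vec x)))))

open Polynomial in
/-- A bound for the running time of the command computing a query. -/
noncomputable def cost : Query B → ℕ[X]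
  | arc _ _ => C 8 * X ^ 2 + C 14 * X + C 8
  | lt _ _ => C 8 * X + C 6
  | mem _ _ => C 8 * X + C 6
  | bin _ e e' => e.cost + e'.cost + C 3
  | fold _ _ e => X * (e.cost + C 12) + C 5
  | few _ e => X * (e.cost + C 22) + C 12
  | iter _ _ e₀ e₁ e => tabulateCost e₀.cost + C 7 * X + X * (tabulateCost e₁.cost + C 1) + e.cost
      + C 4

end Query

namespace Represents

variable {n : ℕ} {M : List Bool} {L : List B} {ρ : B → ℕ} {V : B → List Bool}
  {s s' : Stk B → List Γ'}

theorem withIndex {i : B} {j r : ℕ} (h : Represents n M L ρ V s) (hj : j ≤ n)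
    (hs' : ∀ k, k ≠ res → (∀ b ∈ i :: L, k ≠ rem b ∧ k ≠ buf b) → s' k = s k) :
    Represents n M (i :: L) (update ρ i j) V (withIndex s' i j r) where
  size := by simp [StackProg.withIndex, hs', h.size]
  mat := by simp [StackProg.withIndex, hs', h.mat]
  tmp₁ := by simp [StackProg.withIndex, hs', h.tmp₁]
  tmp₂ := by simp [StackProg.withIndex, hs', h.tmp₂]
  tmp₃ := by simp [StackProg.withIndex, hs', h.tmp₃]
  idx b := by
    obtain rfl | hb := eq_or_ne b i
    · simp [StackProg.withIndex]
    · simp [StackProg.withIndex, hb, hs', h.idx]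
  vec b := by simp [StackProg.withIndex, hs', h.vec]
  le b := by
    obtain rfl | hb := eq_or_ne b i
    · simpa using hj
    · simpa [hb] using h.le b
  fresh b hb := by
    have hbi : b ≠ i := List.ne_of_not_mem_cons hb
    have hs (k : Stk B) (hk : k ≠ res) (hk' : ∀ b' ∈ i :: L, k ≠ rem b' ∧ k ≠ buf b')
        (hki : k ≠ .idx i) (hkr : k ≠ rem i) : StackProg.withIndex s' i j r k = s k := by
      simp [StackProg.withIndex, hki, hkr, hs' k hk hk']
    have : ∀ b' ∈ i :: L, b ≠ b' := fun b' hb' h => hb (h ▸ hb')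
    rw [hs, hs, hs, hs]
    · exact h.fresh b (List.not_mem_of_not_mem_cons hb)
    all_goals grind

theorem update_res (h : Represents n M L ρ V s) (l : List Γ') :
    Represents n M L ρ V (update s res l) := by
  constructor <;> grind [Represents]

theorem update_vec (h : Represents n M L ρ V s) (x : B) (W : List Bool) (l : List Γ') :
    Represents n M (x :: L) ρ (update V x W)
      (update (update s (.vec x) (W.map .bit)) (rem x) l) := by
  constructor <;> grind [Represents]

end Represents

namespace Query

variable {n : ℕ} {M : List Bool} {L : List B} {e e' e₀ e₁ : Query B}

/-- Correctness of the compilation of `e` as long as only names in `L` are in use. -/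
def IsCompiled (n : ℕ) (M : List Bool) (L : List B) (e : Query B) : Prop :=
  ∀ ⦃ρ V s⦄, Represents n M L ρ V s →
    Runs e.compile s (update s res (.bit (e.eval n M ρ V) :: s res)) (e.cost.eval n)

theorem isOne_map_bit (l : List Bool) (j : ℕ) : isOne (l.map Γ'.bit)[j]? = l[j]?.getD false := by
  rw [List.getElem?_map]
  cases l[j]?
  · rfl
  · simp

theorem isCompiled_arc (i j : B) : (arc i j).IsCompiled n M L := by
  intro ρ V s h
  refine ((runs_skipRows i s h.tmp₁ h.tmp₂).seq (runs_lookup (by simp) (by simp) (by simp)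
    (by simp) (by simp) (by simp) (by simp) isOne _ (by simp [h.tmp₁]))).cast ?_ ?_
  · have hval := isOne_map_bit M (ρ i * n + ρ j)
    funext x
    have := h.mat
    have := h.idx i
    have := h.idx j
    have := h.size
    have := h.tmp₃
    simp only [update_apply, eval, ← hval]
    split_ifs <;> simp_all
  · have hi := Nat.mul_le_mul_right n (h.le i)
    have hi' := Nat.mul_le_mul_right (6 * n + 6) (h.le i)
    have hj := h.le j
    have hmin := min_le_left (ρ i * n) M.length
    simp only [h.tmp₃, h.idx, h.size, h.mat, List.length_replicate, ne_eq, reduceCtorEq,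
      not_false_eq_true, update_of_ne, update_self, List.append_nil, List.length_reverse,
      List.length_take, List.length_map, cost, Polynomial.eval_add, Polynomial.eval_mul,
      Polynomial.eval_C, Polynomial.eval_X, pow_two]
    grind

theorem isCompiled_lt {i j : B} (hij : i ≠ j) : (lt i j).IsCompiled n M L := by
  intro ρ V s h
  refine (runs_lookup (by simp) (by simpa using hij) (by simp) (by simp) (by simp) (by simp)
    (by simp) _ _ h.tmp₁).cast ?_ ?_
  · have hval : (List.replicate (ρ j) one)[ρ i]?.isSome = decide (ρ i < ρ j) := by
      rw [List.getElem?_replicate]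
      split_ifs <;> simp_all
    rw [h.idx, h.idx, h.tmp₃, List.length_replicate, hval, List.reverse_nil, List.nil_append,
      ← h.idx j, update_eq_self, ← h.tmp₃, update_eq_self]
    rfl
  · have := h.le i
    simp [h.idx, h.tmp₃, cost]
    omega

theorem isCompiled_mem (x i : B) : (mem x i).IsCompiled n M L := by
  intro ρ V s h
  refine (runs_lookup (by simp) (by simp) (by simp) (by simp) (by simp) (by simp) (by simp) _ _
    h.tmp₁).cast ?_ ?_
  · rw [h.idx, h.vec, h.tmp₃, List.length_replicate, isOne_map_bit, List.reverse_nil,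
      List.nil_append, ← h.vec x, update_eq_self, ← h.tmp₃, update_eq_self]
    rfl
  · have := h.le i
    simp [h.idx, h.tmp₃, cost]
    omega

theorem isCompiled_bin (op : Bool → Bool → Bool) (he : e.IsCompiled n M L)
    (he' : e'.IsCompiled n M L) : (bin op e e').IsCompiled n M L := by
  intro ρ V s h
  refine ((he h).seq ((he' (h.update_res _)).seq (runs_combine op (l := s res)
    (b := e.eval n M ρ V) (b' := e'.eval n M ρ V) (by simp)))).cast ?_ ?_
  · simp [eval]
  · simp [cost]
    omega

theorem isCompiled_fold (op : Bool → Bool → Bool) {i : B} (hi : i ∉ L)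
    (he : e.IsCompiled n M (i :: L)) : (fold op i e).IsCompiled n M L := by
  intro ρ V s h
  obtain ⟨hidx, hrem, -, -⟩ := h.fresh i hi
  let acc (k : ℕ) : Bool :=
    (List.range k).foldl (fun b j => op b (e.eval n M (update ρ i j) V)) false
  refine ((Runs.push _ _ _).seq (runs_forEach (i := i) (n := n) (T := e.cost.eval n + 3)
    (fun j => update s res (.bit (acc j) :: s res)) (by simp [h.size]) (by simp [h.tmp₁])
      (by simp [hidx]) (by simp [hrem]) ?_)).cast rfl ?_
  · intro j r hj
    refine ((he (h.withIndex (by omega) (by simp +contextual))).seq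
      (runs_combine op (l := s res) (b := acc j) (b' := e.eval n M (update ρ i j) V)
        (by simp [withIndex]))).cast ?_ le_rfl
    funext x
    simp only [withIndex, update_apply, acc]
    split_ifs <;> simp_all [List.range_succ]
  · simp [cost]
    ring_nf
    rfl

theorem isCompiled_few {i : B} (hi : i ∉ L) (he : e.IsCompiled n M (i :: L)) :
    (few i e).IsCompiled n M L := by
  intro ρ V s h
  obtain ⟨hidx, hrem, -, hbuf⟩ := h.fresh i hi
  let cnt (k : ℕ) : ℕ := (List.range k).countP fun j => e.eval n M (update ρ i j) V
  have hcnt : cnt n ≤ n := by simpa using List.countP_le_length (l := List.range n)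
  have hloop := runs_forEach (i := i) (n := n) (T := e.cost.eval n + 3)
    (body := .seq e.compile (.pop res fun o =>
      if isOne o then .seq (.push (buf i) one) (.push (buf i) one) else .skip))
    (fun j => update s (buf i) (List.replicate (2 * cnt j) one)) (by simp [h.size])
      (by simp [h.tmp₁]) (by simp [hidx]) (by simp [hrem]) ?_
  · have hstart : update s (buf i) (List.replicate (2 * cnt 0) one) = s := by
      simp [cnt, ← hbuf]
    rw [hstart] at hloop
    refine (hloop.seq (runs_testLeSucc i _ (by simp [h.tmp₁]) (by simp [h.tmp₃]))).cast ?_ ?_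
    · simp [h.size, eval, cnt, ← hbuf]
    · simp [h.size, cost]
      ring_nf
      omega
  · intro j r hj
    refine (he (h.withIndex (by omega) (by simp +contextual))).seq (T₂ := 3)
      (Runs.pop_of_eq (T := 2) (o := some (.bit (e.eval n M (update ρ i j) V))) (l := s res)
        (by simp) (by simp [withIndex]) ?_)
    rcases hv : e.eval n M (update ρ i j) V with _ | _
    · refine (Runs.skip _).cast ?_ (by omega)
      funext x
      simp only [withIndex, update_apply, cnt]
      split_ifs <;> simp_all [List.range_succ]
    · refine ((Runs.push _ _ _).seq (Runs.push _ _ _)).cast ?_ le_rfl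
      funext x
      simp only [withIndex, update_apply, cnt]
      split_ifs <;> simp_all [List.range_succ, Nat.mul_add, List.replicate_succ]

theorem runs_tabulate {ρ : B → ℕ} {V : B → List Bool} {s : Stk B → List Γ'} {x i : B}
    (h : Represents n M (x :: L) ρ V s) (he : e.IsCompiled n M (i :: x :: L)) (hi : i ∉ L)
    (hix : i ≠ x) (hbuf : s (buf x) = []) (hV : (V x).length ≤ n) :
    Runs (tabulate x i e.compile) s
      (update s (vec x) (((List.range n).map fun j => e.eval n M (update ρ i j) V).map Γ'.bit))
      ((tabulateCost e.cost).eval n) := by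
  obtain ⟨hidx, hrem, -, -⟩ := h.fresh i (by simp [hi, hix])
  let val (j : ℕ) : Bool := e.eval n M (update ρ i j) V
  have hloop := runs_forEach (i := i) (n := n) (T := e.cost.eval n + 2)
    (body := .seq e.compile (transfer res (buf x)))
    (fun j => update s (buf x) (((List.range j).map val).map Γ'.bit).reverse)
    (by simp [h.size]) (by simp [h.tmp₁]) (by simp [hidx]) (by simp [hrem]) ?_
  · have hstart : update s (buf x) (((List.range 0).map val).map Γ'.bit).reverse = s := by
      simp [hbuf]
    rw [hstart] at hloop
    refine (hloop.seq ((runs_clear _ _).seq (runs_move (by simp) _))).cast ?_ ?_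
    · funext y
      simp only [update_apply]
      split_ifs <;> simp_all [val]
    · simp [h.vec, tabulateCost, Nat.mul_add]
      omega
  · intro j r hj
    refine ((he (h.withIndex (by omega) (by simp +contextual))).seq
      (runs_transfer (by simp) _)).cast ?_ le_rfl
    funext y
    simp only [withIndex, update_apply, val]
    split_ifs <;> simp_all [List.range_succ]

theorem runs_drain_tabulate {ρ : B → ℕ} {V : B → List Bool} {s : Stk B → List Γ'} {x i : B}
    {F : List Bool → List Bool}
    (hF : ∀ W, F W = (List.range n).map fun j => e.eval n M (update ρ i j) (update V x W))
    (h : Represents n M L ρ V s) (he : e.IsCompiled n M (i :: x :: L)) (hx : x ∉ L) (hi : i ∉ L)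
    (hix : i ≠ x) {W₀ : List Bool} (hW₀ : W₀.length = n) :
    Runs (.drain (rem x) fun _ => tabulate x i e.compile)
      (update (update s (vec x) (W₀.map .bit)) (rem x) (List.replicate n one))
      (update s (vec x) ((F^[n] W₀).map .bit))
      (n * ((tabulateCost e.cost).eval n + 1) + 1) := by
  obtain ⟨-, hrem, -, hbuf⟩ := h.fresh x hx
  have hlen : ∀ k, (F^[k] W₀).length = n :=
    Iterate.rec (fun W : List Bool => W.length = n) hW₀ fun W _ => by simp [hF]
  refine (Runs.drain_replicate (k := rem x) (a := one) (T := (tabulateCost e.cost).eval n)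
    (fun k => update s (vec x) ((F^[k] W₀).map .bit)) fun k r _ => ?_).cast ?_ le_rfl
  · refine (runs_tabulate (h.update_vec x _ _) he hi hix (by simp [hbuf])
      (by simp [hlen])).cast ?_ le_rfl
    rw [← hF, ← iterate_succ_apply' F]
    grind
  · simp [← hrem]

theorem isCompiled_iter {x i : B} (hx : x ∉ L) (hi : i ∉ L) (hix : i ≠ x)
    (he₀ : e₀.IsCompiled n M (i :: x :: L)) (he₁ : e₁.IsCompiled n M (i :: x :: L))
    (he : e.IsCompiled n M (x :: L)) : (iter x i e₀ e₁ e).IsCompiled n M L := by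
  intro ρ V s h
  obtain ⟨-, hrem, hvec, hbuf⟩ := h.fresh x hx
  have hV : V x = [] := by simpa [hvec] using h.vec x
  let F (W : List Bool) : List Bool :=
    (List.range n).map fun j => e₁.eval n M (update ρ i j) (update V x W)
  let W₀ : List Bool := (List.range n).map fun j => e₀.eval n M (update ρ i j) V
  have hstart := runs_tabulate (h.mono (List.subset_cons_self x L)) he₀ hi hix hbuf (by simp [hV])
  have hloop := runs_drain_tabulate (F := F) (fun _ => rfl) h he₁ hx hi hix
    (W₀ := W₀) (by simp [W₀])
  have hlast := he (h.update_vec x (F^[n] W₀) [])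
  rw [show update (update s (vec x) ((F^[n] W₀).map .bit)) (rem x) [] =
    update s (vec x) ((F^[n] W₀).map .bit) by simp [← hrem]] at hlast
  refine (hstart.seq (((runs_copy (by simp) (by simp) (by simp) _ (by simp [h.tmp₁])).cast
    ?_ le_rfl).seq (hloop.seq (hlast.seq (runs_clear _ _))))).cast ?_ ?_
  · simp [h.size, hrem, W₀]
  · simp only [eval]
    grind
  · have hlen : (F^[n] W₀).length = n :=
      Iterate.rec (fun W : List Bool => W.length = n) (by simp [W₀]) (fun W _ => by simp [F]) n
    simp [h.size, hlen, cost]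
    ring_nf
    omega

theorem isCompiled_of_scoped (he : e.Scoped L) : e.IsCompiled n M L := by
  induction e generalizing L with
  | arc i j => exact isCompiled_arc i j
  | lt i j => exact isCompiled_lt he
  | mem x i => exact isCompiled_mem x i
  | bin op e e' ih ih' => exact isCompiled_bin op (ih he.1) (ih' he.2)
  | fold op i e ih => exact isCompiled_fold op he.1 (ih he.2)
  | few i e ih => exact isCompiled_few he.1 (ih he.2)
  | iter x i e₀ e₁ e ih₀ ih₁ ih =>
    obtain ⟨hx, hi, hix, he₀, he₁, he⟩ := he
    exact isCompiled_iter hx hi hix (ih₀ he₀) (ih₁ he₁) (ih he)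

end Query

end StackProg

/-! ### Reading the input -/

namespace StackProg

open Turing Function Computability Stk

/-- The string of the rows of a matrix, each of them being ended by a comma. -/
def rowsString (rows : List (List Bool)) : List Γ' :=
  rows.flatMap fun r => r.map Γ'.bit ++ [Γ'.comma]

theorem count_comma_rowsString (rows : List (List Bool)) :
    (rowsString rows).count Γ'.comma = rows.length := by
  induction rows with
  | nil => rfl
  | cons r rows ih =>
    have hr : (r.map Γ'.bit).count Γ'.comma = 0 := List.count_eq_zero.mpr (by simp)
    rw [rowsString] at ih ⊢
    simp [hr, ih]

theorem filter_ne_comma_rowsString (rows : List (List Bool)) :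
    (rowsString rows).filter (· ≠ Γ'.comma) = rows.flatten.map Γ'.bit := by
  simp [rowsString, List.filter_append, List.filter_map, comp_def,
    List.map_flatten, List.flatMap_def]

theorem length_rowsString (rows : List (List Bool)) :
    (rowsString rows).length = rows.flatten.length + rows.length := by
  simp [rowsString, List.length_flatMap, List.length_flatten, List.sum_map_add]

/-- The input string for a binary number and a matrix. -/
def inputString (bits : List Bool) (rows : List (List Bool)) : List Γ' :=
  bits.map Γ'.bit ++ Γ'.comma :: rowsString rows

variable {B : Type} [DecidableEq B]

/-- Move the symbols of the input preceding the first comma to `tmp₂`. -/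
def readNumber : Cmd (Stk B) Γ' :=
  .seq (.loop inp (fun a => a ≠ Γ'.comma) (.push tmp₁)) (move tmp₁ tmp₂)

theorem runs_readNumber {bits : List Bool} {l : List Γ'} {s : Stk B → List Γ'}
    (h : s inp = bits.map Γ'.bit ++ Γ'.comma :: l) (h₁ : s tmp₁ = []) (h₂ : s tmp₂ = []) :
    Runs readNumber s (update (update s inp l) tmp₂ (bits.map Γ'.bit)) (4 * bits.length + 2) := by
  have hloop : Runs (.loop inp (fun a => a ≠ Γ'.comma) (.push tmp₁)) s
      (update (update s inp l) tmp₁ ((bits.map Γ'.bit).reverse ++ s tmp₁))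
      (2 * bits.length + 1) := by
    clear h₁ h₂
    induction bits generalizing s with
    | nil => exact (Runs.loop_cons_of_false h (by simp)).cast (by simp) (by simp)
    | cons b bits ih =>
      refine (Runs.loop_step h (by simp) (Runs.push _ _ _) (ih (by simp))).cast ?_
        (by rw [List.length_cons]; omega)
      funext x
      simp only [update_apply]
      split_ifs <;> simp_all
  refine (hloop.seq (runs_move (by simp) _)).cast ?_ (by simp [h₁]; omega)
  simp only [h₁, List.append_nil]
  grind

/-- Read the rows of the matrix, counting them on `size`, and move the entries to `mat`. -/
def readRows : Cmd (Stk B) Γ' :=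
  .seq (.drain inp fun a => if a = Γ'.comma then .push size one else .push tmp₁ a) (move tmp₁ mat)

theorem runs_readRows {rows : List (List Bool)} {s : Stk B → List Γ'}
    (h : s inp = rowsString rows) (h₁ : s tmp₁ = []) (hsize : s size = []) (hmat : s mat = []) :
    Runs readRows s (update (update (update s inp []) size (List.replicate rows.length one)) mat
      (rows.flatten.map Γ'.bit)) (4 * (rowsString rows).length + 2) := by
  have hloop := Runs.drain (k := inp) (s := s) (T := 1)
    (f := fun a => if a = Γ'.comma then .push size one else .push tmp₁ a)
    (fun d => update (update s size (List.replicate (d.count Γ'.comma) one)) tmp₁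
      (d.filter (· ≠ Γ'.comma))) (by
      rw [List.count_nil, List.replicate_zero, List.filter_nil]
      grind) ?_
  · refine (hloop.seq (runs_move (by simp) _)).cast ?_ ?_
    · have hcount := count_comma_rowsString rows
      have hfilter := filter_ne_comma_rowsString rows
      simp only [h, List.count_reverse, List.filter_reverse, hcount, hfilter]
      grind
    · have hle := (rowsString rows).reverse.length_filter_le (· ≠ Γ'.comma)
      simp only [h, ne_eq, reduceCtorEq, not_false_eq_true, update_of_ne, update_self] at hle ⊢
      rw [List.length_reverse] at hle
      omega
  · intro d a r _
    by_cases ha : a = Γ'.comma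
    · rw [if_pos ha]
      refine (Runs.push _ _ _).cast ?_ le_rfl
      subst ha
      funext x
      simp only [update_apply]
      split_ifs <;> simp_all [List.replicate_succ]
    · rw [if_neg ha]
      refine (Runs.push _ _ _).cast ?_ le_rfl
      funext x
      simp only [update_apply]
      split_ifs <;> simp_all

/-- Halve the number on `tmp₃`. -/
def halve : Cmd (Stk B) Γ' := .seq (.drain tmp₃ fun _ => transfer tmp₃ tmp₁) (move tmp₁ tmp₃)

theorem runs_halve {m : ℕ} {s : Stk B → List Γ'} (h₁ : s tmp₁ = [])
    (h₃ : s tmp₃ = List.replicate m one) :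
    Runs halve s (update s tmp₃ (List.replicate (m / 2) one)) (3 * m + 3) := by
  have hloop : Runs (.drain tmp₃ fun _ => transfer tmp₃ tmp₁) s
      (update (update s tmp₃ []) tmp₁ (List.replicate (m / 2) one ++ s tmp₁)) (2 * m + 2) := by
    clear h₁
    induction m using Nat.twoStepInduction generalizing s with
    | zero => exact (Runs.loop_nil h₃).cast (by grind) (by omega)
    | one =>
      exact (Runs.loop_step h₃ rfl (runs_transfer (by simp) _) (.loop_nil (by simp))).cast
        (by simp) (by omega)
    | more m ih _ =>
      refine (Runs.loop_step h₃ rfl (runs_transfer (by simp) _)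
        (ih (by simp [List.replicate_succ]))).cast ?_ (by omega)
      have hm : (m + 2) / 2 = m / 2 + 1 := by omega
      have hhead : (List.replicate (m + 1) one).head?.toList = [one] := by
        simp [List.replicate_succ]
      rw [hm, List.replicate_succ' (n := m / 2)]
      grind
  refine (hloop.seq (runs_move (by simp) _)).cast ?_ (by simp [h₁]; omega)
  simp only [h₁, List.append_nil]
  grind

/-- Half of `m`, rounded down if the binary digit `a` is `1` and up if it is `0`. -/
def halfRounded (m : ℕ) (a : Γ') : ℕ := if a = one then m / 2 else (m + 1) / 2

theorem foldl_halfRounded_le (l : List Γ') (m : ℕ) : l.foldl halfRounded m ≤ m := by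
  induction l generalizing m with
  | nil => exact le_rfl
  | cons a l ih =>
    refine (ih _).trans ?_
    rw [halfRounded]
    split_ifs <;> omega

/-- This reduces comparing a number in unary with a number in binary to halving the former, as
`m ≤ b + 2 * N` if and only if `⌈(m - b) / 2⌉ ≤ N`. -/
theorem foldl_halfRounded_eq_zero_iff (bits : List Bool) (m : ℕ) :
    (bits.map Γ'.bit).foldl halfRounded m = 0 ↔ m ≤ Nat.ofDigits 2 (bits.map Bool.toNat) := by
  induction bits generalizing m with
  | nil => simp
  | cons b bits ih =>
    rw [List.map_cons, List.foldl_cons, ih, List.map_cons, Nat.ofDigits_cons]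
    cases b <;> simp [halfRounded, one] <;> omega

/-- Push on `res` whether the order is at most the binary number on `tmp₂`, which is consumed. -/
def compareSize : Cmd (Stk B) Γ' :=
  .seq (copy size tmp₃ tmp₁) (.seq
    (.drain tmp₂ fun a => .seq (if a = one then .skip else .push tmp₃ one) halve)
    (.pop tmp₃ fun o => .seq (.push res (.bit o.isNone)) (clear tmp₃)))

theorem runs_drain_halve {m : ℕ} {s : Stk B → List Γ'} (h₁ : s tmp₁ = [])
    (h₃ : s tmp₃ = List.replicate m one) :
    Runs (.drain tmp₂ fun a => .seq (if a = one then .skip else .push tmp₃ one) halve) s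
      (update (update s tmp₃ (List.replicate ((s tmp₂).foldl halfRounded m) one)) tmp₂ [])
      ((s tmp₂).length * (3 * m + 8) + 1) := by
  refine (Runs.drain (T := 3 * m + 7)
    (fun d => update s tmp₃ (List.replicate (d.reverse.foldl halfRounded m) one))
    (by simp [← h₃]) fun d a r _ => ?_).cast (by simp) le_rfl
  have hle := foldl_halfRounded_le d.reverse m
  simp only [List.reverse_cons, List.foldl_append, List.foldl_cons, List.foldl_nil]
  generalize d.reverse.foldl halfRounded m = k at *
  by_cases ha : a = one
  · rw [if_pos ha, halfRounded, if_pos ha]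
    exact ((Runs.skip _).seq (runs_halve (m := k) (by simp [h₁]) (by simp))).cast (by grind)
      (by omega)
  · rw [if_neg ha, halfRounded, if_neg ha]
    exact ((Runs.push _ _ _).seq (runs_halve (m := k + 1) (by simp [h₁])
      (by simp [List.replicate_succ]))).cast (by grind) (by omega)

theorem runs_compareSize {bits : List Bool} {n : ℕ} {s : Stk B → List Γ'} (h₁ : s tmp₁ = [])
    (h₂ : s tmp₂ = bits.map Γ'.bit) (h₃ : s tmp₃ = []) (hsize : s size = List.replicate n one) :
    Runs compareSize s (update (update s tmp₂ []) res
        (.bit (decide (n ≤ Nat.ofDigits 2 (bits.map Bool.toNat))) :: s res))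
      (bits.length * (3 * n + 8) + 7 * n + 6) := by
  refine ((runs_copy (by simp) (by simp) (by simp) s h₁).seq
    ((runs_drain_halve (m := n) (by simp [h₁]) (by simp [h₃, hsize])).seq
      ((Runs.push _ _ _).seq (runs_clear _ _)).pop)).cast ?_ ?_
  · have htest (m : ℕ) : (List.replicate m one).head?.isNone = decide (m = 0) := by
      cases m <;> simp [List.replicate_succ]
    have hzero := foldl_halfRounded_eq_zero_iff bits n
    funext x
    simp only [update_apply]
    split_ifs <;> simp_all
  · have := foldl_halfRounded_le (bits.map Γ'.bit) n
    simp [h₂, hsize]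
    omega

/-- Push on `res` whether the binary number on `tmp₂` is odd, and whether it has one digit only. -/
def inspect : Cmd (Stk B) Γ' :=
  peek tmp₂ fun o => .seq (.push res (.bit (isOne o)))
    (.seq (transfer tmp₂ tmp₃) (.seq (peek tmp₂ fun o' => .push res (.bit o'.isNone))
      (transfer tmp₃ tmp₂)))

theorem runs_inspect {b : Bool} {bits : List Bool} {s : Stk B → List Γ'}
    (h₂ : s tmp₂ = (b :: bits).map Γ'.bit) (h₃ : s tmp₃ = []) :
    Runs inspect s (update s res (.bit bits.isEmpty :: .bit b :: s res)) 10 := by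
  have h₂₃ : (tmp₂ : Stk B) ≠ tmp₃ := by simp
  refine (runs_peek ((Runs.push _ _ _).seq ((runs_transfer h₂₃ _).seq
    ((runs_peek (Runs.push _ _ _)).seq (runs_transfer h₂₃.symm _))))).cast ?_ (by norm_num)
  have hempty : (bits.map Γ'.bit).head?.isNone = bits.isEmpty := by cases bits <;> rfl
  funext x
  simp only [update_apply]
  split_ifs <;> simp_all

theorem eval_nat_mono (p : Polynomial ℕ) : Monotone fun n => p.eval n := by
  intro m n h
  induction p using Polynomial.induction_on' with
  | add p q hp hq => simpa using add_le_add hp hq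
  | monomial k a => simpa using Nat.mul_le_mul_left a (Nat.pow_le_pow_left h k)

/-- Replace the answers to *odd*, *one digit*, *order at most the number*, `e₁` and `e₂`, found on
`res` with the last one on top, by the final answer. -/
def verdict : Cmd (Stk B) Γ' :=
  .pop res fun o₂ => .pop res fun o₁ => .pop res fun large => .pop res fun unit =>
  .pop res fun odd =>
    .push res (.bit (if isOne large || isOne unit then isOne o₁ else !isOne odd || isOne o₂))

theorem runs_verdict {v₂ v₁ large unit odd : Bool} {l : List Γ'} {s : Stk B → List Γ'}
    (h : s res = .bit v₂ :: .bit v₁ :: .bit large :: .bit unit :: .bit odd :: l) :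
    Runs verdict s (update s res (.bit (if large || unit then v₁ else !odd || v₂) :: l)) 6 := by
  refine (Runs.push _ _ _).pop.pop.pop.pop.pop.cast ?_ le_rfl
  simp [h]

/-- Read the input, and push on `res` the answers to *odd*, *one digit* and *order at most the
number*. -/
def load : Cmd (Stk B) Γ' := .seq (.seq readNumber readRows) (.seq inspect compareSize)

/-- Decide by the query `e₁` if the number is `1` or at least the order, and otherwise by the query
`e₂` if it is odd; accept in the remaining case. -/
def decideBy (e₁ e₂ : Query B) : Cmd (Stk B) Γ' :=
  .seq load (.seq e₁.compile (.seq e₂.compile (.seq verdict (.seq (clear size) (clear mat)))))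

open Polynomial in
/-- A bound for the running time of `decideBy`. -/
noncomputable def decideByCost (e₁ e₂ : Query B) : ℕ[X] :=
  X * (C 3 * X + C 25) + C 30 + e₁.cost + e₂.cost

/-- The stacks once the graph has been read and the results `l` have been obtained. -/
def graphState (n : ℕ) (M : List Bool) (l : List Γ') : Stk B → List Γ' :=
  update (update (update (fun _ => []) size (List.replicate n one)) mat (M.map Γ'.bit)) res l

theorem runs_compile_graphState (n : ℕ) (M : List Bool) (l : List Γ') {e : Query B}
    (he : e.Scoped []) :
    Runs e.compile (graphState n M l)
      (graphState n M (.bit (e.eval n M (fun _ => 0) fun _ => []) :: l)) (e.cost.eval n) := by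
  have hrep : Represents n M ([] : List B) (fun _ => 0) (fun _ => []) (graphState n M l) := by
    constructor <;> simp [graphState]
  exact (Query.isCompiled_of_scoped he hrep).cast (by simp [graphState]) le_rfl

theorem runs_load (b : Bool) (bits : List Bool) (rows : List (List Bool)) :
    Runs load (update (fun _ : Stk B => []) inp (inputString (b :: bits) rows))
      (graphState rows.length rows.flatten
        [.bit (decide (rows.length ≤ Nat.ofDigits 2 ((b :: bits).map Bool.toNat))),
          .bit bits.isEmpty, .bit b])
      (4 * (b :: bits).length + 4 * (rowsString rows).length +
        (b :: bits).length * (3 * rows.length + 8) + 7 * rows.length + 20) := by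
  have hparse := (runs_readNumber (B := B)
    (s := update (fun _ => []) inp (inputString (b :: bits) rows)) (update_self ..) (by simp)
    (by simp)).seq (runs_readRows (rows := rows) (by simp) (by simp) (by simp) (by simp))
  refine (hparse.seq ((runs_inspect (b := b) (bits := bits) (by simp) (by simp)).seq
    (runs_compareSize (bits := b :: bits) (n := rows.length) (by simp) (by simp) (by simp)
      (by simp)))).cast ?_ (by omega)
  funext x
  simp only [graphState, update_apply]
  split_ifs <;> simp_all

theorem runs_decideBy {e₁ e₂ : Query B} (h₁ : e₁.Scoped []) (h₂ : e₂.Scoped []) (b : Bool)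
    (bits : List Bool) (rows : List (List Bool)) :
    Runs (decideBy e₁ e₂) (update (fun _ => []) inp (inputString (b :: bits) rows))
      (update (fun _ => []) res [.bit
        (if decide (rows.length ≤ Nat.ofDigits 2 ((b :: bits).map Bool.toNat)) || bits.isEmpty then
          e₁.eval rows.length rows.flatten (fun _ => 0) (fun _ => [])
        else !b || e₂.eval rows.length rows.flatten (fun _ => 0) (fun _ => []))])
      ((decideByCost e₁ e₂).eval (inputString (b :: bits) rows).length) := by
  refine ((runs_load b bits rows).seq ((runs_compile_graphState _ _ _ h₁).seq
    ((runs_compile_graphState _ _ _ h₂).seq ((runs_verdict (update_self ..)).seq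
      ((runs_clear size _).seq (runs_clear mat _)))))).cast ?_ ?_
  · funext x
    simp only [update_apply]
    split_ifs <;> simp_all
  · set ℓ := (inputString (b :: bits) rows).length with hℓ
    have hlen : ℓ = bits.length + 2 + (rows.flatten.length + rows.length) := by
      rw [hℓ, inputString, List.length_append, List.length_cons, length_rowsString]
      simp
      omega
    have hcost₁ : e₁.cost.eval rows.length ≤ e₁.cost.eval ℓ := eval_nat_mono _ (by omega)
    have hcost₂ : e₂.cost.eval rows.length ≤ e₂.cost.eval ℓ := eval_nat_mono _ (by omega)
    have hcompare : (bits.length + 1) * (3 * rows.length + 8) ≤ ℓ * (3 * ℓ + 8) :=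
      Nat.mul_le_mul (by omega) (by omega)
    have hring : ℓ * (3 * ℓ + 25) = ℓ * (3 * ℓ + 8) + 17 * ℓ := by ring
    simp [decideByCost, length_rowsString, -List.length_flatten, -List.map_flatten]
    omega

end StackProg

/-! ### The decision procedure -/

namespace StackProg

open Turing Function Computability

theorem encodePosNum_eq_bits (m : PosNum) : encodePosNum m = (m : ℕ).bits := by
  induction m with
  | one => simp [encodePosNum]
  | bit0 m ih =>
    rw [encodePosNum, ih, PosNum.cast_bit0, ← two_mul, Nat.bit0_bits _ (PosNum.cast_pos m).ne']
  | bit1 m ih => rw [encodePosNum, ih, PosNum.cast_bit1, ← two_mul, Nat.bit1_bits]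

theorem encodeNat_eq_bits (p : ℕ) : encodeNat p = p.bits := by
  have encodeNum_eq_bits (m : Num) : encodeNum m = (m : ℕ).bits := by
    rcases m with _ | m
    · simp [encodeNum]
    · exact encodePosNum_eq_bits m
  rw [encodeNat, encodeNum_eq_bits, Num.to_of_nat]

theorem ofDigits_map_toNat_bits (p : ℕ) : Nat.ofDigits 2 (p.bits.map Bool.toNat) = p := by
  conv_rhs => rw [← Nat.ofDigits_digits 2 p, Nat.digits_two_eq_bits]
  rfl

theorem bits_eq_bodd_cons {p : ℕ} (hp : p ≠ 0) : p.bits = p.bodd :: p.div2.bits := by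
  conv_lhs => rw [← Nat.bit_bodd_div2 p]
  refine Nat.bits_append_bit _ _ fun h => ?_
  have := Nat.bodd_add_div2 p
  cases hb : p.bodd <;> simp_all

theorem getElem?_flatten_of_forall_length_eq {α : Type*} {L : List (List α)} {n j : ℕ}
    (hL : ∀ l ∈ L, l.length = n) (hj : j < n) (i : ℕ) :
    L.flatten[i * n + j]? = L[i]?.bind (·[j]?) := by
  induction L generalizing i with
  | nil => simp
  | cons l L ih =>
    obtain ⟨hl, hL⟩ := List.forall_mem_cons.mp hL
    rcases i with _ | i
    · simp [List.getElem?_append_left (hj.trans_eq hl.symm)]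
    · rw [List.flatten_cons, List.getElem?_append_right (by rw [hl, Nat.succ_mul]; omega),
        show (i + 1) * n + j - l.length = i * n + j by rw [hl, Nat.succ_mul]; omega, ih hL]
      rfl

/-- The rows of the adjacency matrix. -/
noncomputable def adjRows {n : ℕ} (D : OrientedGraph (Fin n)) : List (List Bool) :=
  open scoped Classical in
  List.ofFn fun u => List.ofFn fun v => decide (D.Adj u v)

theorem length_adjRows {n : ℕ} (D : OrientedGraph (Fin n)) : (adjRows D).length = n :=
  List.length_ofFn

theorem getD_flatten_adjRows {n : ℕ} (D : OrientedGraph (Fin n)) (u v : Fin n) :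
    (adjRows D).flatten[(u : ℕ) * n + v]?.getD false = true ↔ D.Adj u v := by
  rw [getElem?_flatten_of_forall_length_eq (by simp [adjRows]) v.2]
  simp [adjRows]

theorem encode_eq_inputString (I : EqInversionInstance) :
    I.encode = inputString I.p.bits (adjRows I.graph) := by
  simp only [EqInversionInstance.encode, encodeNat_eq_bits, inputString, rowsString, adjRows,
    EqInversionInstance.encodeRow, List.ofFn_eq_map, List.flatMap_map, List.map_map]
  rfl

/-- A truth value as an element of the field with two elements. -/
def toZMod (b : Bool) : ZMod 2 := if b then 1 else 0

theorem toZMod_eq_one_iff {b : Bool} : toZMod b = 1 ↔ b = true := by cases b <;> decide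

theorem toZMod_xor (b c : Bool) : toZMod (xor b c) = toZMod b + toZMod c := by
  cases b <;> cases c <;> decide

theorem toZMod_and (b c : Bool) : toZMod (b && c) = toZMod b * toZMod c := by
  cases b <;> cases c <;> decide

namespace Query

section Semantics

variable {B : Type} [DecidableEq B] {n : ℕ}

theorem eval_fold_or (i : B) (e : Query B) (M : List Bool) (ρ : B → ℕ) (V : B → List Bool) :
    (fold or i e).eval n M ρ V = true ↔ ∃ j : Fin n, e.eval n M (update ρ i j) V = true := by
  have foldl_or (l : List ℕ) (b : Bool) :
      l.foldl (fun b j => b || e.eval n M (update ρ i j) V) b = true ↔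
        b = true ∨ ∃ j ∈ l, e.eval n M (update ρ i j) V = true := by
    induction l generalizing b with
    | nil => simp
    | cons a l ih => simp [ih, or_assoc]
  rw [eval, foldl_or]
  simp [Fin.exists_iff]

theorem toZMod_eval_fold_xor (i : B) (e : Query B) (M : List Bool) (ρ : B → ℕ)
    (V : B → List Bool) : toZMod ((fold xor i e).eval n M ρ V) =
      ∑ j : Fin n, toZMod (e.eval n M (update ρ i j) V) := by
  have foldl_xor (l : List ℕ) (b : Bool) :
      toZMod (l.foldl (fun b j => xor b (e.eval n M (update ρ i j) V)) b) =
        toZMod b + (l.map fun j => toZMod (e.eval n M (update ρ i j) V)).sum := by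
    induction l generalizing b with
    | nil => simp
    | cons a l ih => simp [ih, toZMod_xor, add_assoc]
  rw [eval, foldl_xor, Fin.sum_univ_def, ← List.map_coe_finRange_eq_range, List.map_map]
  exact zero_add _

theorem eval_few (i : B) (e : Query B) (M : List Bool) (ρ : B → ℕ) (V : B → List Bool) :
    (few i e).eval n M ρ V = true ↔
      2 * (Finset.univ.filter fun j : Fin n => e.eval n M (update ρ i j) V = true).card
        ≤ n + 1 := by
  rw [eval, decide_eq_true_eq, ← List.map_coe_finRange_eq_range, List.countP_map,
    ← List.toFinset_finRange n, (List.nodup_finRange n).card_eq_countP]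
  refine iff_of_eq (congrArg (2 * · ≤ n + 1) (List.countP_congr fun j _ => ?_))
  simp

theorem iterate_map_range_getD {g₀ : ℕ → Bool} {g₁ : List Bool → ℕ → Bool} {P₀ : Fin n → Prop}
    {F : (Fin n → Prop) → Fin n → Prop} (h₀ : ∀ i : Fin n, g₀ i = true ↔ P₀ i)
    (h₁ : ∀ W P, (∀ i : Fin n, W[(i : ℕ)]?.getD false = true ↔ P i) →
      ∀ i : Fin n, g₁ W i = true ↔ F P i) (t : ℕ) (i : Fin n) :
    ((fun W => (List.range n).map (g₁ W))^[t] ((List.range n).map g₀))[(i : ℕ)]?.getD false = true ↔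
      F^[t] P₀ i := by
  induction t generalizing i with
  | zero => simp [h₀]
  | succ t ih =>
    rw [iterate_succ_apply', iterate_succ_apply', ← h₁ _ _ ih]
    simp

theorem exists_eval_iter {x i : B} {e₀ e₁ : Query B} (e : Query B) {M : List Bool} {ρ : B → ℕ}
    {V : B → List Bool} {P₀ : Fin n → Prop} {F : (Fin n → Prop) → Fin n → Prop}
    (h₀ : ∀ j : Fin n, e₀.eval n M (update ρ i j) V = true ↔ P₀ j)
    (h₁ : ∀ W P, (∀ j : Fin n, W[(j : ℕ)]?.getD false = true ↔ P j) →
      ∀ j : Fin n, e₁.eval n M (update ρ i j) (update V x W) = true ↔ F P j) :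
    ∃ W, (∀ j : Fin n, W[(j : ℕ)]?.getD false = true ↔ F^[n] P₀ j) ∧
      (iter x i e₀ e₁ e).eval n M ρ V = e.eval n M ρ (update V x W) :=
  ⟨_, iterate_map_range_getD h₀ h₁ n, rfl⟩

end Semantics

/-- The query for acyclicity: starting from all vertices, and replacing `n` times a set of vertices
by the set of its out-neighbours, no vertex is left. -/
def acyclic : Query (Fin 4) :=
  .iter 3 0 (.bin (fun _ _ => true) (.arc 0 0) (.arc 0 0))
    (.fold or 1 (.bin and (.mem 3 1) (.arc 1 0)))
    (.bin (fun a _ => !a) (.fold or 0 (.mem 3 0)) (.arc 0 0))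

/-- Evaluate `e` where the set `3` is the connected component of the vertex `0` in the complement,
that is, in the graph of the pairs that are not joined by an arc. -/
def withComponent (e : Query (Fin 4)) : Query (Fin 4) :=
  .iter 3 1 (.bin (fun a b => !a && !b) (.lt 1 0) (.lt 0 1))
    (.fold or 2 (.bin and (.mem 3 2) (.bin (fun a b => !a && !b) (.arc 2 1) (.arc 1 2)))) e

/-- The vertex `0` is the least vertex of the set `3`, and `e` holds. Counting the vertices `0` for
which this is the case counts the components for which `e` holds. -/
def andLeast (e : Query (Fin 4)) : Query (Fin 4) :=
  .bin (fun a b => a && !b) e (.fold or 1 (.bin and (.mem 3 1) (.lt 1 0)))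

/-- The parity (`OrientedGraph.parity`) of the set `3`, taken as a component of the complement. -/
def componentParity : Query (Fin 4) :=
  .fold xor 1 (.bin and (.mem 3 1) (.fold xor 2 (.bin or (.bin and (.mem 3 2) (.lt 2 1))
    (.bin (fun a b => a && !b) (.arc 1 2) (.mem 3 2)))))

/-- The parity of the number of elements of the set `3`. -/
def cardParity : Query (Fin 4) := .fold xor 1 (.mem 3 1)

/-- The two counting inequalities of `OrientedGraph.isEqInvertible_iff_card`. -/
def balanced : Query (Fin 4) :=
  .bin and (.few 0 (withComponent (andLeast componentParity)))
    (.few 0 (withComponent (andLeast (.bin xor cardParity componentParity))))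

theorem acyclic_scoped : acyclic.Scoped [] := by
  simp [acyclic, Scoped]

theorem balanced_scoped : balanced.Scoped [] := by
  simp [balanced, withComponent, andLeast, componentParity, cardParity, Scoped]

variable {n : ℕ} (D : OrientedGraph (Fin n))

theorem eval_acyclic (ρ : Fin 4 → ℕ) (V : Fin 4 → List Bool) :
    acyclic.eval n (adjRows D).flatten ρ V = true ↔ D.IsAcyclic := by
  obtain ⟨W, hW, h⟩ := exists_eval_iter (n := n) (x := 3) (i := 0)
    (e₀ := .bin (fun _ _ => true) (.arc 0 0) (.arc 0 0))
    (e₁ := .fold or 1 (.bin and (.mem 3 1) (.arc 1 0)))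
    (.bin (fun a _ => !a) (.fold or 0 (.mem 3 0)) (.arc 0 0)) (M := (adjRows D).flatten) (ρ := ρ)
    (V := V) (P₀ := fun _ => True) (F := D.outSet) (fun j => by simp [eval]) (fun W P hW j => by
      rw [eval_fold_or]
      simp [eval, hW, getD_flatten_adjRows, OrientedGraph.outSet])
  rw [acyclic, h, D.isAcyclic_iff_iterate, Fintype.card_fin]
  change (!(fold or 0 (.mem 3 0)).eval n _ ρ (update V 3 W)) = true ↔ _
  rw [Bool.not_eq_true', ← Bool.not_eq_true, eval_fold_or]
  simp [eval, hW]

theorem exists_eval_withComponent (e : Query (Fin 4)) {ρ : Fin 4 → ℕ} (V : Fin 4 → List Bool)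
    {v : Fin n} (hv : ρ 0 = v) :
    ∃ W, (∀ u : Fin n, W[(u : ℕ)]?.getD false = true ↔ D.root u = D.root v) ∧
      (withComponent e).eval n (adjRows D).flatten ρ V =
        e.eval n (adjRows D).flatten ρ (update V 3 W) := by
  obtain ⟨W, hW, h⟩ := exists_eval_iter (n := n) (x := 3) (i := 1)
    (e₀ := .bin (fun a b => !a && !b) (.lt 1 0) (.lt 0 1))
    (e₁ := .fold or 2 (.bin and (.mem 3 2) (.bin (fun a b => !a && !b) (.arc 2 1) (.arc 1 2))))
    e (M := (adjRows D).flatten) (ρ := ρ) (V := V) (P₀ := fun u => u = v) (F := D.nonNeighbors)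
    (fun j => by simp [eval, hv, Fin.ext_iff]; omega) (fun W P hW j => by
      rw [eval_fold_or]
      simp [eval, hW, ← Bool.not_eq_true, getD_flatten_adjRows, OrientedGraph.nonNeighbors])
  have hroot (u : Fin n) := D.iterate_nonNeighbors_iff v u
  rw [Fintype.card_fin] at hroot
  exact ⟨W, fun u => (hW u).trans (hroot u), h⟩

variable {D} {ρ : Fin 4 → ℕ} {V : Fin 4 → List Bool} {v : Fin n}

theorem eval_andLeast (e : Query (Fin 4)) (hv : ρ 0 = v)
    (hV : ∀ u : Fin n, (V 3)[(u : ℕ)]?.getD false = true ↔ D.root u = D.root v) :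
    (andLeast e).eval n (adjRows D).flatten ρ V = true ↔
      D.root v = v ∧ e.eval n (adjRows D).flatten ρ V = true := by
  change (e.eval n _ ρ V && !(fold or 1 (.bin and (.mem 3 1) (.lt 1 0))).eval n _ ρ V) = true ↔ _
  rw [Bool.and_eq_true, and_comm, Bool.not_eq_true', ← Bool.not_eq_true, eval_fold_or,
    D.root_eq_self_iff]
  simp [eval, hV, hv]

theorem toZMod_eval_weight {u w : Fin n}
    (hV : ∀ x : Fin n, (V 3)[(x : ℕ)]?.getD false = true ↔ D.root x = D.root u)
    (hu : ρ 1 = u) (hw : ρ 2 = w) :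
    toZMod ((bin or (.bin and (.mem 3 2) (.lt 2 1))
      (.bin (fun a b => a && !b) (.arc 1 2) (.mem 3 2))).eval n (adjRows D).flatten ρ V) =
        D.weight u w := by
  have hmem := hV w
  have harc := getD_flatten_adjRows D u w
  simp only [eval, toZMod, OrientedGraph.weight, hu, hw, Fin.val_fin_lt]
  by_cases hr : D.root u = D.root w
  · simp [hr, hmem.mpr hr.symm]
  · rw [if_neg hr, Bool.eq_false_of_not_eq_true (mt hmem.mp (Ne.symm hr))]
    classical exact if_congr (by simp [harc]) rfl rfl

theorem toZMod_eval_componentParity (hv : D.root v = v)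
    (hV : ∀ u : Fin n, (V 3)[(u : ℕ)]?.getD false = true ↔ D.root u = D.root v) :
    toZMod (componentParity.eval n (adjRows D).flatten ρ V) = D.parity v := by
  rw [componentParity, toZMod_eval_fold_xor, OrientedGraph.parity, Finset.sum_filter]
  refine Finset.sum_congr rfl fun u _ => ?_
  change toZMod (_ && (fold xor 2 _).eval n _ _ V) = _
  rw [toZMod_and, toZMod_eval_fold_xor]
  have hu : (mem 3 1).eval n (adjRows D).flatten (update ρ 1 u) V = true ↔ D.root u = v := by
    simp [eval, hV, hv]
  split_ifs with h
  · rw [toZMod_eq_one_iff.mpr (hu.mpr h), one_mul]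
    exact Finset.sum_congr rfl fun w _ =>
      toZMod_eval_weight (by rwa [h, ← hv]) (by simp) (by simp)
  · rw [Bool.eq_false_of_not_eq_true (mt hu.mp h)]
    exact zero_mul _

theorem toZMod_eval_cardParity (hv : D.root v = v)
    (hV : ∀ u : Fin n, (V 3)[(u : ℕ)]?.getD false = true ↔ D.root u = D.root v) :
    toZMod (cardParity.eval n (adjRows D).flatten ρ V) =
      OrientedGraph.fiberParity D.root Finset.univ v := by
  rw [cardParity, toZMod_eval_fold_xor, OrientedGraph.fiberParity, ← Finset.sum_boole]
  refine Finset.sum_congr rfl fun u _ => ?_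
  simp [eval, toZMod, hV, hv]

theorem eval_few_withComponent_andLeast {e : Query (Fin 4)} {a : Fin n → ZMod 2}
    (he : ∀ (ρ : Fin 4 → ℕ) (V : Fin 4 → List Bool) (v : Fin n), D.root v = v →
      (∀ u : Fin n, (V 3)[(u : ℕ)]?.getD false = true ↔ D.root u = D.root v) →
      toZMod (e.eval n (adjRows D).flatten ρ V) = a v)
    (ha : ∀ v, D.root v ≠ v → a v = 0) :
    (few 0 (withComponent (andLeast e))).eval n (adjRows D).flatten ρ V = true ↔
      2 * (Finset.univ.filter fun r => a r = 1).card ≤ n + 1 := by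
  have heval (v : Fin n) : (withComponent (andLeast e)).eval n (adjRows D).flatten
      (update ρ 0 v) V = true ↔ a v = 1 := by
    have hv : update ρ 0 (v : ℕ) 0 = v := update_self ..
    obtain ⟨W, hW, h⟩ := exists_eval_withComponent D (andLeast e) V hv
    rw [← update_self (β := fun _ => List Bool) 3 W V] at hW
    rw [h, eval_andLeast e hv hW]
    by_cases hr : D.root v = v
    · rw [← he _ _ v hr hW, toZMod_eq_one_iff, and_iff_right hr]
    · simp [hr, ha v hr]
  simp only [eval_few, heval]

theorem eval_balanced (ρ : Fin 4 → ℕ) (V : Fin 4 → List Bool) :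
    balanced.eval n (adjRows D).flatten ρ V = true ↔
      2 * (Finset.univ.filter fun r => D.parity r = 1).card ≤ n + 1 ∧
      2 * (Finset.univ.filter fun r =>
        OrientedGraph.fiberParity D.root Finset.univ r + D.parity r = 1).card ≤ n + 1 := by
  have hparity (v : Fin n) (hv : D.root v ≠ v) : D.parity v = 0 := by
    rw [OrientedGraph.parity, D.filter_root_eq_empty hv, Finset.sum_empty]
  have hfiber (v : Fin n) (hv : D.root v ≠ v) :
      OrientedGraph.fiberParity D.root Finset.univ v = 0 := by
    rw [OrientedGraph.fiberParity, D.filter_root_eq_empty hv, Finset.card_empty, Nat.cast_zero]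
  change (_ && _) = true ↔ _
  rw [Bool.and_eq_true]
  refine and_congr (eval_few_withComponent_andLeast
    (fun ρ V v hv hV => toZMod_eval_componentParity hv hV) hparity)
    (eval_few_withComponent_andLeast (fun ρ V v hv hV => ?_) fun v hv => ?_)
  · rw [← toZMod_eval_componentParity hv hV (ρ := ρ), ← toZMod_eval_cardParity hv hV (ρ := ρ),
      ← toZMod_xor]
    rfl
  · rw [hfiber v hv, hparity v hv, add_zero]

end Query

theorem ite_eval_eq_answer (I : EqInversionInstance) :
    (if decide (I.n ≤ I.p) || I.p.div2.bits.isEmpty then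
      Query.acyclic.eval I.n (adjRows I.graph).flatten (fun _ => 0) (fun _ => [])
    else !I.p.bodd || Query.balanced.eval I.n (adjRows I.graph).flatten (fun _ => 0) (fun _ => []))
      = I.answer := by
  classical
  have hne := I.order_ne
  have hpos := I.p_pos
  have hisEmpty : I.p.div2.bits.isEmpty = true ↔ I.p = 1 := by
    rw [List.isEmpty_iff, ← List.length_eq_zero_iff, Nat.size_eq_bits_len, Nat.size_eq_zero,
      Nat.div2_val]
    omega
  have hbodd : I.p.bodd = decide (Odd I.p) := by
    rw [Bool.eq_iff_iff, decide_eq_true_iff, Nat.odd_iff, Nat.mod_two_of_bodd]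
    cases I.p.bodd <;> simp
  rw [EqInversionInstance.answer, Bool.eq_iff_iff, decide_eq_true_iff]
  split_ifs with hc
  · rw [Query.eval_acyclic, OrientedGraph.isEqInvertible_iff_isAcyclic]
    simpa [hisEmpty, or_comm] using hc
  · simp only [Bool.or_eq_true, decide_eq_true_eq, hisEmpty, not_or] at hc
    have hV : I.p + 2 ≤ Fintype.card (Fin I.n) := by
      rw [Fintype.card_fin]
      omega
    rcases I.p.even_or_odd with heven | hodd
    · refine iff_of_true ?_ (I.graph.isEqInvertible_of_even (by omega) heven hV)
      simp [hbodd, heven]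
    · rw [I.graph.isEqInvertible_iff_card (by rw [Nat.odd_iff] at hodd; omega) hodd hV,
        Fintype.card_fin, ← Query.eval_balanced (fun _ => 0) (fun _ => [])]
      simp [hbodd, hodd]

end StackProg

theorem theorem3 :
    ∃ M : Turing.TM2ComputableInPolyTime EqInversionInstance.encode Computability.encodeBool
        EqInversionInstance.answer,
      ∀ k, Finite (M.tm.Γ k) := by
  open StackProg in
  refine exists_tm2ComputableInPolyTime (decideBy .acyclic .balanced) .inp .res
    (fun a => isOne (some a)) EqInversionInstance.encode EqInversionInstance.answer
    (decideByCost .acyclic .balanced) fun I => ?_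
  have hbits := bits_eq_bodd_cons I.p_pos.ne'
  have hrun := runs_decideBy Query.acyclic_scoped Query.balanced_scoped I.p.bodd I.p.div2.bits
    (adjRows I.graph)
  rw [← hbits, ofDigits_map_toNat_bits, length_adjRows, ite_eval_eq_answer,
    ← encode_eq_inputString] at hrun
  exact ⟨_, isOne_bit _, hrun⟩
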